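/- **Setting.** Let $N$ be a finite ground set with $n$ elements, $f\colon 2^N\to\mathbb R_{\ge 0}$ a non-negative monotone submodular function ($f(S)\le f(T)$ for $S\subseteq T$, and $f(S\cap T)+f(S\cup T)\le f(S)+f(T)$ for all $S,T$), and $M=(N,\mathcal I)$ a matroid of rank $r$. An algorithm knows $N$ and accesses $f$ and $M$ only through a value oracle ($S\mapsto f(S)$) and an independence oracle ($S\mapsto$ whether $S\in\mathcal I$), which it may query adaptively at arbitrary $S\subseteq N$; a randomized algorithm may in addition roll fair dice. The query complexity is the total number of queries to both oracles (for a randomized algorithm, for the worst outcome of the dice). *Non-oblivious local search.* Fix an integer $\ell\ge 2$ and reals $\alpha_0=0$, $\alpha_1,\dots,\alpha_\ell>0$. A set $S\subseteq N\times[\ell]$ encodes the sets $S_i=\{u : (u,i)\in S\}$; let $\pi_J(S)=\bigcup_{i\in J}S_i$ for $J \subseteq [\ell]$, and $$g(S)=\sum_{J\subseteq[\ell]}\alpha_{|J|}\, f(\pi_J(S)).$$ Let $M'$ be the matroid on $N\times[\ell]$ in which $S$ is independent iff $S_1,\dots,S_\ell$ are pairwise disjoint and $\pi_{[\ell]}(S)\in\mathcal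 I$. A *local search run* is a non-empty list of bases of $M'$ in which each entry after the first arises from its predecessor $S$ by an exchange $S\mapsto (S\setminus\{p\})\cup\{q\}$ with $p\in S$, $q\notin S$, which does not decrease $g$. If $S$ is the final entry, then the run returns $\pi_{[\ell]}(S)\subseteq N$. For $\delta>0$, an independent set $S$ of $M'$ is a *$\delta$-approximate local optimum* of $g$ if for every independent set $T$ of $M'$ $$\sum_{v\in T}\bigl[g(S\cup\{v\})-g(S\setminus\{v\})\bigr]-\sum_{u\in S}\bigl[g(S)-g(S\setminus\{u\})\bigr]\le\delta\cdot\max\{g(O): O \text{ independent in } M'\}.$$ **Theorem.** There is an absolute constant $k$ such that for every $\varepsilon>0$ there are $\ell\ge2$, $\alpha_0=0$, $\alpha_1,\dots,\alpha_\ell>0$ and $C$, depending only on $\varepsilon$, such that for every finite ground set $N$ the following hold. 1. There is a deterministic algorithm that, for all $f$ and $M$ as above, produces a local search run whose final entry is an $\varepsilon$-approximate local optimum of $g$, and returns an independent set $X\in\mathcal I$ with $$f(X)\ge\left(1-\tfrac1e-\varepsilon\right)\max_{O\in\mathcal I}f(O);$$ if $r\ge1$, it makes at most $C\, n r\,(1+\log(n+1))^k=\tilde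 O_\varepsilon(nr)$ queries. 2. There is a randomized algorithm that, for all $f$ and $M$ as above, always produces a local search run and returns an independent set $X\in\mathcal I$, such that with probability at least $1-\varepsilon$ the final entry of the run is an $\varepsilon$-approximate local optimum of $g$, $$\mathbb E[f(X)]\ge\left(1-\tfrac1e-\varepsilon\right)\max_{O\in\mathcal I}f(O),$$ and it makes at most $C\,(n+r\sqrt n)(1+\log(n+1))^k=\tilde O_\varepsilon(n+r\sqrt n)$ queries. -/

import Mathlib

/-- `f` is a non-negative monotone submodular set function. -/
structure IsMonotoneSubmodular {N : Type*} [DecidableEq N] (f : Finset N → ℝ) : Prop where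
  nonneg : ∀ S, 0 ≤ f S
  mono : ∀ S T, S ⊆ T → f S ≤ f T
  submod : ∀ S T, f (S ∩ T) + f (S ∪ T) ≤ f S + f T

/-- An adaptive algorithm with a value oracle and an independence oracle for subsets of `N`, which
may toss fair dice and which returns an element of `β`. What the algorithm does next after a query
(after a die roll) is an arbitrary function of the answer, hence of everything seen so far. -/
inductive QueryAlg (N : Type*) (β : Type*) where
  /-- stop and return `b` -/
  | ret (b : β) : QueryAlg N β
  /-- ask for the value of the objective at `S` -/
  | value (S : Finset N) (next : ℝ → QueryAlg N β) : QueryAlg N β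
  /-- ask whether `S` is independent -/
  | indep (S : Finset N) (next : Bool → QueryAlg N β) : QueryAlg N β
  /-- draw a uniformly random element of a set with `m + 1` elements -/
  | roll (m : ℕ) (next : Fin (m + 1) → QueryAlg N β) : QueryAlg N β

namespace QueryAlg

variable {N : Type*} {β : Type*}

/-- A deterministic algorithm never rolls a die. -/
def IsDeterministic : QueryAlg N β → Prop
  | ret _ => True
  | value _ next => ∀ x, (next x).IsDeterministic
  | indep _ next => ∀ b, (next b).IsDeterministic
  | roll _ _ => False

/-- The set of all results that the algorithm returns for some outcome of its die rolls, when the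
value oracle is `v` and the independence oracle is `I`. For a deterministic algorithm this is the
singleton of its result. -/
def outputs (v : Finset N → ℝ) (I : Finset N → Bool) : QueryAlg N β → Set β
  | ret b => {b}
  | value S next => outputs v I (next (v S))
  | indep S next => outputs v I (next (I S))
  | roll _ next => ⋃ i, outputs v I (next i)

/-- The number of oracle queries (of both kinds together), for the worst outcome of the rolls. -/
def queries (v : Finset N → ℝ) (I : Finset N → Bool) : QueryAlg N β → ℕ
  | ret _ => 0
  | value S next => queries v I (next (v S)) + 1
  | indep S next => queries v I (next (I S)) + 1
  | roll _ next => Finset.univ.sup fun i => queries v I (next i)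

/-- The expected value of `φ` at the result of the algorithm. -/
noncomputable def expect (v : Finset N → ℝ) (I : Finset N → Bool) (φ : β → ℝ) :
    QueryAlg N β → ℝ
  | ret b => φ b
  | value S next => expect v I φ (next (v S))
  | indep S next => expect v I φ (next (I S))
  | roll m next => (∑ i, expect v I φ (next i)) / (m + 1)

open Classical in
/-- The probability that the result of the algorithm satisfies `P`. -/
noncomputable def prob (v : Finset N → ℝ) (I : Finset N → Bool) (P : β → Prop)
    (A : QueryAlg N β) : ℝ :=
  A.expect v I fun b => if P b then 1 else 0

end QueryAlg

open Classical in
/-- The independence oracle of a matroid. -/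
noncomputable def indepOracle {N : Type*} (M : Matroid N) (S : Finset N) : Bool :=
  decide (M.Indep (S : Set N))

/-- A set `S` of pairs `(u, i)` encodes the tuple `(S₁, …, S_ℓ)` with `S_i = {u | (u, i) ∈ S}`;
`unionOf S J` is the union of the sets `S_i` with `i ∈ J`. -/
def unionOf {N : Type*} [DecidableEq N] {l : ℕ} (S : Finset (N × Fin l)) (J : Finset (Fin l)) :
    Finset N :=
  (S.filter fun p => p.2 ∈ J).image Prod.fst

/-- The auxiliary objective `g(S₁, …, S_ℓ) = ∑_{J ⊆ [ℓ]} α_{|J|} f(⋃_{i ∈ J} S_i)`. -/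
def auxObjective {N : Type*} [DecidableEq N] {l : ℕ} (f : Finset N → ℝ) (α : ℕ → ℝ)
    (S : Finset (N × Fin l)) : ℝ :=
  ∑ J : Finset (Fin l), α J.card * f (unionOf S J)

/-- The lifted matroid: a set of pairs is independent when no two of its pairs have the same first
component (that is, the sets `S_i` are disjoint) and its projection to `N` is independent. -/
def liftMatroid {N : Type*} (M : Matroid N) (l : ℕ) : Matroid (N × Fin l) :=
  M.comap Prod.fst

/-- One step of the local search: replace one pair by another one. (Between bases of the lifted
matroid this moves an element from one `S_i` to another one, or it removes an element and puts a
new element into one of the sets.) -/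
def IsExchange {N : Type*} [DecidableEq N] {l : ℕ} (S S' : Finset (N × Fin l)) : Prop :=
  ∃ p ∈ S, ∃ q, q ∉ S ∧ S' = insert q (S.erase p)

/-- The course of a local search guided by the auxiliary objective: a non-empty list of tuples of
disjoint sets whose union is a base, in which every tuple arises from its predecessor by one
exchange step that does not decrease the auxiliary objective. -/
def IsLocalSearchRun {N : Type*} [DecidableEq N] {l : ℕ} (f : Finset N → ℝ) (M : Matroid N)
    (α : ℕ → ℝ) (L : List (Finset (N × Fin l))) : Prop :=
  L ≠ [] ∧ (∀ S ∈ L, (liftMatroid M l).IsBase (S : Set (N × Fin l))) ∧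
    L.IsChain fun S S' => IsExchange S S' ∧ auxObjective f α S ≤ auxObjective f α S'

/-- The tuple at which the local search stops. -/
def finalTuple {N : Type*} {l : ℕ} (L : List (Finset (N × Fin l))) : Finset (N × Fin l) :=
  L.getLastD ∅

/-- The solution that the local search returns: the union of the sets of the final tuple. -/
def solution {N : Type*} [DecidableEq N] {l : ℕ} (L : List (Finset (N × Fin l))) : Finset N :=
  unionOf (finalTuple L) Finset.univ

/-- `S` is a `δ`-approximate local optimum of `g` with respect to the independent sets of `M`:
`∑_{v ∈ T} g(v | S - v) - ∑_{u ∈ S} g(u | S - u) ≤ δ g(O)` for every independent `T`, where `O` is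
an independent set that maximizes `g`. -/
def IsApproxLocalOpt {X : Type*} [DecidableEq X] (g : Finset X → ℝ) (M : Matroid X) (δ : ℝ)
    (S : Finset X) : Prop :=
  M.Indep (S : Set X) ∧
    ∀ O : Finset X, M.Indep (O : Set X) → (∀ T : Finset X, M.Indep (T : Set X) → g T ≤ g O) →
      ∀ T : Finset X, M.Indep (T : Set X) →
        ∑ v ∈ T, (g (insert v (S.erase v)) - g (S.erase v)) -
          ∑ u ∈ S, (g (insert u (S.erase u)) - g (S.erase u)) ≤ δ * g O

/-! Approximation. Apply the local-optimality inequality to `T = O × {i}` for every layer `i` and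
sum over `i`. Submodularity bounds the gains from below by `∑_J |J| α_{|J|} (f(O) - f(π_J S))`
(`le_sum_sum_marginals`) and the losses from above by `∑_J α_{|J|} ∑_{i ∈ J} (f(π_J S) - f(π_{J - i}
S))` (`sum_marginals_auxObjective_le`). The weights of `auxWeight` satisfy a recursion
(`auxWeight_succ`) that makes the coefficients of `f(π_J S)` cancel for all `J` except `∅` and
`[l]`. What remains is the ratio `1 - (1 + 1/l)^(-l)`, which tends to `1 - 1/e`, up to an error
proportional to `δ` (`le_of_isApproxLocalOpt`).

Search. Any independent `T` can be matched into a base `S` by exchanges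
(`exists_exchange_injection`), so the violation of local optimality is at most a sum, over at most
`r` exchanges `(u, v)`, of `g(S + v) - g(S) - (g(S) - g(S - u))`. Each such term is also a lower
bound for the true gain of the exchange. As `u` and `v` are separated in it, the best partner `u` of
a given `v` is found by sorting the `u` by `g(S - u)` and by a binary search with the independence
oracle (`findPartner_spec`, `step_spec`).

Deterministic algorithm: among about `r K` best steps, one has a guaranteed gain of at most `max g /
(r K)`, and the run stopped before it is at a `1/K`-approximate local optimum (`bestPrefix_spec`). A
step costs `Õ(n)` queries.

Randomized algorithm: a step looks only at random sets of `s` leaving and `t` entering elements,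
with `s t` of order `n`. Pairwise negative correlation shows that it gains in expectation at least
`1/(12 r)` of the violation (`le_expect_randomStep`). Hence the violation at a uniformly random time
below `r K` is at most `12 max g / K` in expectation, and Markov's inequality applies. With `s =
min(r, √(n/2))` the `r K` steps cost `Õ(n + r √n)`.

Both searches run on `N × [l]`; `simulate` replaces a query for `g` by `2^l` queries for `f`. -/

/-! ### Composition of oracle algorithms: results, query counts, expectations. -/

namespace QueryAlg

variable {N : Type*} {β γ : Type*}

/-- Sequential composition of algorithms. -/
def bind : QueryAlg N β → (β → QueryAlg N γ) → QueryAlg N γ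
  | ret b, k => k b
  | value S next, k => value S fun x => (next x).bind k
  | indep S next, k => indep S fun b => (next b).bind k
  | roll m next, k => roll m fun i => (next i).bind k

theorem IsDeterministic.bind {A : QueryAlg N β} {k : β → QueryAlg N γ} (hA : A.IsDeterministic)
    (hk : ∀ b, (k b).IsDeterministic) : (A.bind k).IsDeterministic := by
  induction A with
  | ret b => exact hk b
  | value S next ih => exact fun x => ih x (hA x)
  | indep S next ih => exact fun x => ih x (hA x)
  | roll m next ih => exact hA.elim

variable (v : Finset N → ℝ) (I : Finset N → Bool)

theorem outputs_bind (A : QueryAlg N β) (k : β → QueryAlg N γ) :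
    (A.bind k).outputs v I = ⋃ b ∈ A.outputs v I, (k b).outputs v I := by
  induction A with
  | ret b => simp [bind, outputs]
  | value S next ih => simp [bind, outputs, ih]
  | indep S next ih => simp [bind, outputs, ih]
  | roll m next ih =>
    simp only [bind, outputs, ih]
    ext x
    simp only [Set.mem_iUnion]
    grind

theorem mem_outputs_bind {A : QueryAlg N β} {k : β → QueryAlg N γ} {c : γ} :
    c ∈ (A.bind k).outputs v I ↔ ∃ b ∈ A.outputs v I, c ∈ (k b).outputs v I := by
  simp [outputs_bind]

/-- The continuation is bounded only at results that can occur, so invariants such as being at a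
base may enter cost bounds. -/
theorem queries_bind_le {A : QueryAlg N β} {k : β → QueryAlg N γ} {a c : ℕ}
    (hA : A.queries v I ≤ a) (hk : ∀ b ∈ A.outputs v I, (k b).queries v I ≤ c) :
    (A.bind k).queries v I ≤ a + c := by
  induction A generalizing a with
  | ret b => exact (hk b rfl).trans (Nat.le_add_left _ _)
  | value S next ih =>
    simp only [queries, bind] at hA ⊢
    have := ih (v S) (a := a - 1) (by omega) hk
    omega
  | indep S next ih =>
    simp only [queries, bind] at hA ⊢
    have := ih (I S) (a := a - 1) (by omega) hk
    omega
  | roll m next ih =>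
    simp only [queries, bind, Finset.sup_le_iff, Finset.mem_univ, true_imp_iff] at hA ⊢
    exact fun i => ih i (hA i) fun b hb => hk b (Set.mem_iUnion.2 ⟨i, hb⟩)

theorem expect_bind (A : QueryAlg N β) (k : β → QueryAlg N γ) (φ : γ → ℝ) :
    (A.bind k).expect v I φ = A.expect v I fun b => (k b).expect v I φ := by
  induction A with
  | ret b => rfl
  | value S next ih => exact ih _
  | indep S next ih => exact ih _
  | roll m next ih => simp [bind, expect, ih]

theorem expect_mono {A : QueryAlg N β} {φ ψ : β → ℝ} (h : ∀ b ∈ A.outputs v I, φ b ≤ ψ b) :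
    A.expect v I φ ≤ A.expect v I ψ := by
  induction A with
  | ret b => exact h b rfl
  | value S next ih => exact ih _ h
  | indep S next ih => exact ih _ h
  | roll m next ih =>
    simp only [expect]
    gcongr with i
    exact ih i fun b hb => h b (Set.mem_iUnion.2 ⟨i, hb⟩)

theorem expect_add (A : QueryAlg N β) (φ ψ : β → ℝ) :
    A.expect v I (fun b => φ b + ψ b) = A.expect v I φ + A.expect v I ψ := by
  induction A with
  | ret b => rfl
  | value S next ih => exact ih _
  | indep S next ih => exact ih _
  | roll m next ih => simp [expect, ih, Finset.sum_add_distrib, add_div]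

theorem expect_const_mul (A : QueryAlg N β) (c : ℝ) (φ : β → ℝ) :
    A.expect v I (fun b => c * φ b) = c * A.expect v I φ := by
  induction A with
  | ret b => rfl
  | value S next ih => exact ih _
  | indep S next ih => exact ih _
  | roll m next ih => simp [expect, ih, ← Finset.mul_sum, mul_div_assoc]

theorem expect_const (A : QueryAlg N β) (c : ℝ) : A.expect v I (fun _ => c) = c := by
  induction A with
  | ret b => rfl
  | value S next ih => exact ih _
  | indep S next ih => exact ih _
  | roll m next ih =>
    simp only [expect, ih, Finset.sum_const, Finset.card_univ, Fintype.card_fin, nsmul_eq_mul]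
    push_cast
    field_simp

theorem expect_sum {ι : Type*} (s : Finset ι) (A : QueryAlg N β) (φ : ι → β → ℝ) :
    A.expect v I (fun b => ∑ i ∈ s, φ i b) = ∑ i ∈ s, A.expect v I (φ i) := by
  classical
  induction s using Finset.induction_on with
  | empty => simpa using expect_const v I A 0
  | insert a s ha ih => simp [Finset.sum_insert ha, expect_add, ih]

/-- Draw a uniformly random element of `s` (or return `d` if there is none). -/
noncomputable def sample (s : Finset β) (d : β) : QueryAlg N β :=
  if h : s.Nonempty then
    roll (s.card - 1) fun i =>
      ret (s.equivFin.symm (Fin.cast (Nat.sub_add_cancel h.card_pos) i)).1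
  else ret d

theorem queries_sample (s : Finset β) (d : β) :
    (sample s d : QueryAlg N β).queries v I = 0 := by
  unfold sample
  split_ifs
  · simp only [queries]
    exact Nat.le_zero.1 (Finset.sup_le fun _ _ => le_rfl)
  · rfl

theorem mem_of_mem_outputs_sample {s : Finset β} {d b : β} (hs : s.Nonempty)
    (hb : b ∈ (sample s d : QueryAlg N β).outputs v I) : b ∈ s := by
  simp only [sample, dif_pos hs, outputs, Set.mem_iUnion, Set.mem_singleton_iff] at hb
  obtain ⟨i, rfl⟩ := hb
  exact Subtype.prop _

theorem expect_sample {s : Finset β} (d : β) (hs : s.Nonempty) (φ : β → ℝ) :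
    (sample s d : QueryAlg N β).expect v I φ = (∑ b ∈ s, φ b) / s.card := by
  have h : s.card - 1 + 1 = s.card := Nat.sub_add_cancel hs.card_pos
  simp only [sample, dif_pos hs, expect]
  have h1 : ((s.card - 1 : ℕ) : ℝ) + 1 = s.card := by exact_mod_cast h
  rw [h1, ← Finset.sum_coe_sort s]
  congr 1
  exact Fintype.sum_equiv ((finCongr h).trans s.equivFin.symm) _ _ fun i => rfl

/-- The table of the values of `v` at the sets in `L`. -/
noncomputable def table [DecidableEq N] (L : List (Finset N)) (S : Finset N) : ℝ :=
  if S ∈ L then v S else 0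

theorem table_of_mem [DecidableEq N] {L : List (Finset N)} {S : Finset N} (h : S ∈ L) :
    table v L S = v S := if_pos h

/-- Query the values at all sets in `L`. -/
def readValues [DecidableEq N] : List (Finset N) → QueryAlg N (Finset N → ℝ)
  | [] => ret fun _ => 0
  | S :: L => value S fun x => (readValues L).bind fun F => ret (Function.update F S x)

section readValues

variable [DecidableEq N] (L : List (Finset N))

theorem table_cons (S : Finset N) : table v (S :: L) = Function.update (table v L) S (v S) := by
  funext T
  by_cases h : T = S <;> simp [table, h]

theorem readValues_isDeterministic : (readValues L).IsDeterministic := by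
  induction L with
  | nil => trivial
  | cons S L ih => exact fun x => ih.bind fun F => trivial

theorem outputs_readValues : (readValues L).outputs v I = {table v L} := by
  induction L with
  | nil => simp [readValues, outputs]; rfl
  | cons S L ih => simp [readValues, outputs, outputs_bind, ih, table_cons]

theorem queries_readValues : (readValues L).queries v I ≤ L.length := by
  induction L with
  | nil => simp [readValues, queries]
  | cons S L ih =>
    simp only [readValues, queries, List.length_cons, add_le_add_iff_right]
    exact queries_bind_le v I (c := 0) ih fun b _ => le_rfl

theorem expect_readValues (φ : (Finset N → ℝ) → ℝ) :
    (readValues L).expect v I φ = φ (table v L) := by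
  induction L generalizing φ with
  | nil => simp [readValues, expect]; rfl
  | cons S L ih => simp [readValues, expect, expect_bind, ih, table_cons]

end readValues

end QueryAlg

/-! ### Binary search, greedy bases, and simulation of the lifted oracles. -/

namespace QueryAlg

variable {N : Type*} {β : Type*}

/-- Binary search, with at most `k` independence queries, for a position where the sets `Q j` with
`lo ≤ j ≤ hi` turn from independent to dependent. -/
def search (Q : ℕ → Finset N) : ℕ → ℕ → ℕ → QueryAlg N ℕ
  | 0, _, hi => ret hi
  | k + 1, lo, hi =>
    if hi ≤ lo + 1 then ret hi
    else indep (Q ((lo + hi) / 2)) fun b =>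
      bif b then search Q k ((lo + hi) / 2) hi else search Q k lo ((lo + hi) / 2)

theorem search_isDeterministic (Q : ℕ → Finset N) (k lo hi : ℕ) :
    (search Q k lo hi).IsDeterministic := by
  induction k generalizing lo hi with
  | zero => trivial
  | succ k ih =>
    unfold search
    split_ifs
    · trivial
    · rintro (_ | _)
      exacts [ih _ _, ih _ _]

theorem queries_search (v : Finset N → ℝ) (I : Finset N → Bool) (Q : ℕ → Finset N)
    (k lo hi : ℕ) : (search Q k lo hi).queries v I ≤ k := by
  induction k generalizing lo hi with
  | zero => exact le_rfl
  | succ k ih =>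
    unfold search
    split_ifs
    · exact Nat.zero_le _
    · simp only [queries, add_le_add_iff_right]
      cases I (Q ((lo + hi) / 2))
      exacts [ih _ _, ih _ _]

/-- The invariant "independent at `lo`, dependent at `hi`" survives each halving; `Q` need not be
monotone. -/
theorem search_spec (v : Finset N → ℝ) (I : Finset N → Bool) (Q : ℕ → Finset N) {k lo hi j : ℕ}
    (hlt : lo < hi) (hle : hi ≤ lo + 2 ^ k) (hlo : I (Q lo) = true) (hhi : I (Q hi) = false)
    (hj : j ∈ (search Q k lo hi).outputs v I) :
    ∃ i, j = i + 1 ∧ i < hi ∧ I (Q i) = true ∧ I (Q (i + 1)) = false := by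
  induction k generalizing lo hi with
  | zero =>
    simp only [search, outputs, Set.mem_singleton_iff] at hj
    obtain rfl : hi = lo + 1 := by simp at hle; omega
    exact ⟨lo, hj, hlt, hlo, hhi⟩
  | succ k ih =>
    unfold search at hj
    split_ifs at hj with h
    · simp only [outputs, Set.mem_singleton_iff] at hj
      obtain rfl : hi = lo + 1 := by omega
      exact ⟨lo, hj, hlt, hlo, hhi⟩
    · rw [pow_succ] at hle
      simp only [outputs] at hj
      cases hb : I (Q ((lo + hi) / 2))
      · rw [hb] at hj
        obtain ⟨i, h1, h2, h3⟩ := ih (by omega) (by omega) hlo hb hj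
        exact ⟨i, h1, by omega, h3⟩
      · rw [hb] at hj
        obtain ⟨i, h1, h2, h3⟩ := ih (by omega) (by omega) hb hhi hj
        exact ⟨i, h1, by omega, h3⟩

/-- Go through the elements of a list and add each of them to `B` if `B` remains independent. -/
def greedyBase [DecidableEq N] : List N → Finset N → QueryAlg N (Finset N)
  | [], B => ret B
  | x :: L, B => indep (insert x B) fun b => greedyBase L (bif b then insert x B else B)

section greedyBase

variable [DecidableEq N] (L : List N) (B : Finset N)

theorem greedyBase_isDeterministic : (greedyBase L B).IsDeterministic := by
  induction L generalizing B with
  | nil => trivial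
  | cons x L ih => exact fun b => ih _

theorem queries_greedyBase (v : Finset N → ℝ) (I : Finset N → Bool) :
    (greedyBase L B).queries v I = L.length := by
  induction L generalizing B with
  | nil => rfl
  | cons x L ih => simp [greedyBase, queries, ih]

/-- A rejected element stays rejected, because dependence passes to supersets. -/
theorem greedyBase_spec (v : Finset N → ℝ) (M : Matroid N) {B B' : Finset N}
    (hB : M.Indep (B : Set N)) (h : B' ∈ (greedyBase L B).outputs v (indepOracle M)) :
    B ⊆ B' ∧ M.Indep (B' : Set N) ∧
      ∀ x ∈ L, M.Indep ((insert x B' : Finset N) : Set N) → x ∈ B' := by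
  induction L generalizing B with
  | nil =>
    simp only [greedyBase, outputs, Set.mem_singleton_iff] at h
    subst h
    exact ⟨subset_rfl, hB, by simp⟩
  | cons x L ih =>
    simp only [greedyBase, outputs] at h
    by_cases hx : M.Indep ((insert x B : Finset N) : Set N)
    · have : indepOracle M (insert x B) = true := by simpa [indepOracle] using hx
      rw [this] at h
      obtain ⟨h1, h2, h3⟩ := ih hx h
      refine ⟨(Finset.subset_insert _ _).trans h1, h2, ?_⟩
      rintro y hy hy'
      rcases List.mem_cons.1 hy with rfl | hy
      · exact h1 (Finset.mem_insert_self _ _)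
      · exact h3 y hy hy'
    · have : indepOracle M (insert x B) = false := by simpa [indepOracle] using hx
      rw [this] at h
      obtain ⟨h1, h2, h3⟩ := ih hB h
      refine ⟨h1, h2, ?_⟩
      rintro y hy hy'
      rcases List.mem_cons.1 hy with rfl | hy
      · exact absurd (hy'.subset (by exact_mod_cast Finset.insert_subset_insert _ h1)) hx
      · exact h3 y hy hy'

theorem isBase_of_mem_outputs_greedyBase (v : Finset N → ℝ) (M : Matroid N) (hL : ∀ x, x ∈ L) {B : Finset N}
    (h : B ∈ (greedyBase L ∅).outputs v (indepOracle M)) : M.IsBase (B : Set N) := by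
  obtain ⟨-, h2, h3⟩ := greedyBase_spec L v M (by simp) h
  refine h2.isBase_of_forall_insert fun x hx hx' => hx.2 ?_
  exact_mod_cast h3 x (hL x) (by simpa using hx')

end greedyBase

section simulate

variable [DecidableEq N] {l : ℕ}

open Classical in
/-- Run an algorithm for the auxiliary objective and the lifted matroid, with the oracles of the
original objective and the original matroid. -/
noncomputable def simulate (α : ℕ → ℝ) : QueryAlg (N × Fin l) β → QueryAlg N β
  | ret b => ret b
  | value S next =>
    (readValues ((Finset.univ : Finset (Finset (Fin l))).toList.map (unionOf S))).bind fun F =>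
      (next (auxObjective F α S)).simulate α
  | indep S next =>
    if Set.InjOn Prod.fst (S : Set (N × Fin l)) then
      indep (S.image Prod.fst) fun b => (next b).simulate α
    -- Two pairs over the same element are dependent in the lift whatever `M` is, so the answer is
    -- known without a query.
    else (next false).simulate α
  | roll m next => roll m fun i => (next i).simulate α

variable (f : Finset N → ℝ) (M : Matroid N) (α : ℕ → ℝ) (A : QueryAlg (N × Fin l) β)

/-- The table vanishes off the queried sets, but the auxiliary objective at `S` reads only the sets
`unionOf S J`, all of which were queried. -/
theorem auxObjective_table (S : Finset (N × Fin l)) :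
    auxObjective (table f ((Finset.univ : Finset (Finset (Fin l))).toList.map (unionOf S))) α S =
      auxObjective f α S := by
  refine Finset.sum_congr rfl fun J _ => ?_
  rw [table_of_mem]
  exact List.mem_map.2 ⟨J, by simp, rfl⟩

theorem indepOracle_liftMatroid_of_injOn {S : Finset (N × Fin l)}
    (h : Set.InjOn Prod.fst (S : Set (N × Fin l))) :
    indepOracle (liftMatroid M l) S = indepOracle M (S.image Prod.fst) := by
  simp only [indepOracle, decide_eq_decide]
  simp [liftMatroid, h]

omit [DecidableEq N] in
theorem indepOracle_liftMatroid_of_not_injOn {S : Finset (N × Fin l)}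
    (h : ¬ Set.InjOn Prod.fst (S : Set (N × Fin l))) :
    indepOracle (liftMatroid M l) S = false := by
  simp [indepOracle, liftMatroid, h]

variable {A} in
theorem IsDeterministic.simulate (hA : A.IsDeterministic) : (A.simulate α).IsDeterministic := by
  induction A with
  | ret b => trivial
  | value S next ih => exact (readValues_isDeterministic _).bind fun F => ih _ (hA _)
  | indep S next ih =>
    unfold QueryAlg.simulate
    split_ifs
    · exact fun b => ih _ (hA b)
    · exact ih _ (hA _)
  | roll m next ih => exact hA.elim

theorem outputs_simulate : (A.simulate α).outputs f (indepOracle M) =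
    A.outputs (auxObjective f α) (indepOracle (liftMatroid M l)) := by
  induction A with
  | ret b => rfl
  | value S next ih =>
    simp [simulate, outputs_bind, outputs_readValues, outputs, ih, auxObjective_table]
  | indep S next ih =>
    unfold simulate
    split_ifs with h
    · simp [outputs, ih, indepOracle_liftMatroid_of_injOn M h]
    · simp [outputs, ih, indepOracle_liftMatroid_of_not_injOn M h]
  | roll m next ih => simp [simulate, outputs, ih]

theorem expect_simulate (φ : β → ℝ) : (A.simulate α).expect f (indepOracle M) φ =
    A.expect (auxObjective f α) (indepOracle (liftMatroid M l)) φ := by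
  induction A with
  | ret b => rfl
  | value S next ih =>
    simp [simulate, expect_bind, expect_readValues, expect, ih, auxObjective_table]
  | indep S next ih =>
    unfold simulate
    split_ifs with h
    · simp [expect, ih, indepOracle_liftMatroid_of_injOn M h]
    · simp [expect, ih, indepOracle_liftMatroid_of_not_injOn M h]
  | roll m next ih => simp [simulate, expect, ih]

theorem queries_simulate_le : (A.simulate α).queries f (indepOracle M) ≤
    2 ^ l * A.queries (auxObjective f α) (indepOracle (liftMatroid M l)) := by
  induction A with
  | ret b => exact Nat.zero_le _
  | value S next ih =>
    simp only [simulate, queries, mul_add, mul_one]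
    rw [add_comm]
    refine queries_bind_le f _ ?_ fun F hF => ?_
    · exact (queries_readValues f _ _).trans (by simp)
    · rw [outputs_readValues, Set.mem_singleton_iff] at hF
      rw [hF, auxObjective_table]
      exact ih _
  | indep S next ih =>
    have hl : 1 ≤ 2 ^ l := Nat.one_le_two_pow
    unfold simulate
    split_ifs with h
    · simp only [queries, indepOracle_liftMatroid_of_injOn M h, mul_add, mul_one]
      exact add_le_add (ih _) hl
    · simp only [queries, indepOracle_liftMatroid_of_not_injOn M h, mul_add, mul_one]
      exact (ih _).trans (Nat.le_add_right _ _)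
  | roll m next ih =>
    refine Finset.sup_le fun i hi => (ih i).trans (Nat.mul_le_mul_left _ ?_)
    exact Finset.le_sup (f := fun i => queries _ _ (next i)) hi

end simulate

end QueryAlg

/-! ### Matching an independent set into a base. -/

section Exchange

variable {X : Type*} [Fintype X] [DecidableEq X] {M : Matroid X} {S T : Finset X}

/-- `B` lies in `S - u + v`, which has exactly the size of a base, so the two are equal. -/
theorem isBase_insert_erase_of_subset {B : Set X} {u v : X} (hS : M.IsBase (S : Set X))
    (hB : M.IsBase B) (hBS : B ⊆ insert v (S : Set X)) (hv : v ∉ S) (hu : u ∈ S) (huB : u ∉ B) :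
    M.IsBase ((insert v (S.erase u) : Finset X) : Set X) := by
  have h1 : B ⊆ ((insert v (S.erase u) : Finset X) : Set X) := by
    intro x hx
    have hxu : x ≠ u := fun h => huB (h ▸ hx)
    rcases hBS hx with rfl | hx
    · simp
    · simp only [Finset.coe_insert, Finset.coe_erase]
      exact Or.inr ⟨hx, hxu⟩
  have h2 : ((insert v (S.erase u) : Finset X) : Set X).ncard ≤ B.ncard := by
    rw [Set.ncard_coe_finset, Finset.card_insert_of_notMem (by simp [hv]),
      Finset.card_erase_add_one hu, hB.ncard_eq_ncard_of_isBase hS, Set.ncard_coe_finset]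
  exact Set.eq_of_subset_of_ncard_le h1 h2 (Set.toFinite _) ▸ hB

omit [Fintype X] in
theorem not_indep_insert (hS : M.IsBase (S : Set X)) {v : X} (hv : v ∉ S) :
    ¬ M.Indep ((insert v S : Finset X) : Set X) := fun h => by
  have := hS.eq_of_subset_indep h (by simp)
  exact hv (by exact_mod_cast this ▸ (by simp : v ∈ ((insert v S : Finset X) : Set X)))

omit [DecidableEq X] in
theorem card_le_of_indep (hS : M.IsBase (S : Set X)) (hT : M.Indep (T : Set X)) :
    T.card ≤ S.card := by
  obtain ⟨B, hB, hTB⟩ := hT.exists_isBase_superset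
  have := Set.ncard_le_ncard hTB (Set.toFinite _)
  rwa [hB.ncard_eq_ncard_of_isBase hS, Set.ncard_coe_finset, Set.ncard_coe_finset] at this

/-- An independent set can be matched into a base by exchanges. -/
theorem exists_exchange_injection (hS : M.IsBase (S : Set X)) (hT : M.Indep (T : Set X)) :
    ∃ h : X → X, Set.InjOn h (T \ S : Finset X) ∧ ∀ v ∈ T \ S, h v ∈ S \ T ∧
      M.IsBase ((insert v (S.erase (h v)) : Finset X) : Set X) := by
  classical
  let t : {v // v ∈ T \ S} → Finset X := fun v =>
    (S \ T).filter fun u => M.IsBase ((insert v.1 (S.erase u) : Finset X) : Set X)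
  -- Hall's theorem for the graph joining `v` to the elements of `S \ T` that it can replace. A set
  -- `A` violating Hall's condition has a neighbourhood which, together with `S ∩ T`, is smaller
  -- than the independent set `A ∪ (S ∩ T)`.
  obtain ⟨h, hinj, hmem⟩ := (Finset.all_card_le_biUnion_card_iff_exists_injective t).1 (by
    intro A
    by_contra! hlt
    let A' : Finset X := A.map (Function.Embedding.subtype _)
    have hA' : A' ⊆ T \ S := by
      intro x hx
      obtain ⟨y, -, rfl⟩ := Finset.mem_map.1 hx
      exact y.2
    have hU : A.biUnion t ⊆ S \ T :=
      Finset.biUnion_subset.2 fun v _ => Finset.filter_subset _ _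
    have hI : M.Indep ((A' ∪ (S ∩ T) : Finset X) : Set X) := hT.subset (by
      intro x hx
      have := @hA' x
      simp at hx this ⊢
      tauto)
    have hJ : M.Indep ((A.biUnion t ∪ (S ∩ T) : Finset X) : Set X) := hS.indep.subset (by
      intro x hx
      have := @hU x
      simp only [Finset.coe_union, Set.mem_union, Finset.mem_coe, Finset.mem_inter,
        Finset.mem_sdiff] at hx this ⊢
      tauto)
    have hd1 : Disjoint A' (S ∩ T) := Finset.disjoint_left.2 fun x hx hx' => by
      have := hA' hx
      simp at this hx'
      tauto
    have hcard : (A.biUnion t ∪ (S ∩ T)).card < (A' ∪ (S ∩ T)).card := by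
      rw [Finset.card_union_of_disjoint hd1, Finset.card_map]
      exact (Finset.card_union_le _ _).trans_lt (by omega)
    -- Augmentation yields `x ∈ A` independent of the neighbourhood. Extended inside `S + x` to a
    -- base `B`, it must omit some `u ∈ S`, which `x` can therefore replace. So `u` is a neighbour
    -- of `x` or lies in `S ∩ T`; in both cases it is in `B`, a contradiction.
    obtain ⟨x, hx, hx', hins⟩ := hJ.augment_finset hI hcard
    have hxA : x ∈ A' := by
      simp only [Finset.mem_union] at hx hx'
      tauto
    have hxS : x ∉ S := (Finset.mem_sdiff.1 (hA' hxA)).2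
    obtain ⟨B, hB, hJB, hBS⟩ := hins.exists_isBase_subset_union_isBase hS
    have hBS' : B ⊆ insert x (S : Set X) := by
      intro y hy
      rcases hBS hy with hy | hy
      · rcases hy with rfl | hy
        · exact Or.inl rfl
        · right
          simp only [Finset.coe_union, Set.mem_union, Finset.mem_coe, Finset.mem_inter] at hy
          rcases hy with hy | hy
          · exact (Finset.mem_sdiff.1 (hU hy)).1
          · exact hy.1
      · exact Or.inr hy
    have hnot : ¬ (S : Set X) ⊆ B := fun hSB => by
      have : ((insert x S : Finset X) : Set X) ⊆ B := by
        rw [Finset.coe_insert]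
        exact Set.insert_subset (hJB (Or.inl rfl)) hSB
      exact not_indep_insert hS hxS (hB.indep.subset this)
    obtain ⟨u, huS, huB⟩ := Set.not_subset.1 hnot
    have hbase := isBase_insert_erase_of_subset hS hB hBS' hxS huS huB
    have huJ : u ∉ A.biUnion t ∪ (S ∩ T) := fun h => huB (hJB (Or.inr (by exact_mod_cast h)))
    apply huJ
    obtain ⟨y, hy, rfl⟩ := Finset.mem_map.1 hxA
    refine Finset.mem_union_left _ (Finset.mem_biUnion.2 ⟨y, hy, Finset.mem_filter.2 ⟨?_, hbase⟩⟩)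
    refine Finset.mem_sdiff.2 ⟨huS, fun huT => huJ ?_⟩
    exact Finset.mem_union_right _ (Finset.mem_inter.2 ⟨huS, huT⟩))
  refine ⟨fun v => if hv : v ∈ T \ S then h ⟨v, hv⟩ else v, ?_, ?_⟩
  · intro a ha b hb hab
    have ha' : a ∈ T \ S := ha
    have hb' : b ∈ T \ S := hb
    simp only [dif_pos ha', dif_pos hb'] at hab
    exact congrArg Subtype.val (hinj hab)
  · intro v hv
    have := hmem ⟨v, hv⟩
    simpa only [dif_pos hv, t, Finset.mem_filter] using this

end Exchange

/-! ### Bounding the violation of local optimality by exchanges. -/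

section LocalOptimality

variable {X : Type*} [DecidableEq X]

/-- The left-hand side of the definition of a local optimum. -/
def exchangeGain (g : Finset X → ℝ) (S T : Finset X) : ℝ :=
  ∑ v ∈ T, (g (insert v (S.erase v)) - g (S.erase v)) -
    ∑ u ∈ S, (g (insert u (S.erase u)) - g (S.erase u))

theorem exchangeGain_self (g : Finset X → ℝ) (S : Finset X) : exchangeGain g S S = 0 := sub_self _

namespace IsMonotoneSubmodular

variable {g : Finset X → ℝ} (hg : IsMonotoneSubmodular g)
include hg

theorem marginal_anti {A B : Finset X} (hAB : A ⊆ B) {v : X} (hv : v ∉ B) :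
    g (insert v B) - g B ≤ g (insert v A) - g A := by
  have h := hg.submod (insert v A) B
  have h1 : insert v A ∩ B = A := by
    ext x
    have := @hAB x
    simp only [Finset.mem_inter, Finset.mem_insert]
    grind
  have h2 : insert v A ∪ B = insert v B := by
    rw [Finset.insert_union, Finset.union_eq_right.2 hAB]
  rw [h1, h2] at h
  linarith

/-- Elements of `S ∩ T` contribute equally to both sums and cancel. Unmatched elements of `S \ T`
enter with a minus sign and a nonnegative marginal, so they may be dropped. -/
theorem exchangeGain_le {S T : Finset X} {h : X → X} (hinj : Set.InjOn h (T \ S : Finset X))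
    (hmem : ∀ v ∈ T \ S, h v ∈ S \ T) :
    exchangeGain g S T ≤ ∑ v ∈ T \ S, (g (insert v S) - g S - (g S - g (S.erase (h v)))) := by
  have h1 : ∑ v ∈ T, (g (insert v (S.erase v)) - g (S.erase v)) =
      ∑ v ∈ T \ S, (g (insert v S) - g S) + ∑ v ∈ S ∩ T, (g S - g (S.erase v)) := by
    rw [← Finset.sum_sdiff (Finset.inter_subset_left : T ∩ S ⊆ T), Finset.sdiff_inter_self_left,
      Finset.inter_comm T S]
    congr 1
    · refine Finset.sum_congr rfl fun v hv => ?_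
      rw [Finset.erase_eq_of_notMem (Finset.mem_sdiff.1 hv).2]
    · refine Finset.sum_congr rfl fun v hv => ?_
      rw [Finset.insert_erase (Finset.mem_inter.1 hv).1]
  have h2 : ∑ u ∈ S, (g (insert u (S.erase u)) - g (S.erase u)) =
      ∑ u ∈ S \ T, (g S - g (S.erase u)) + ∑ u ∈ S ∩ T, (g S - g (S.erase u)) := by
    rw [← Finset.sum_sdiff (Finset.inter_subset_left : S ∩ T ⊆ S), Finset.sdiff_inter_self_left]
    congr 1 <;> refine Finset.sum_congr rfl fun v hv => ?_
    · rw [Finset.insert_erase (Finset.mem_sdiff.1 hv).1]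
    · rw [Finset.insert_erase (Finset.mem_inter.1 hv).1]
  have h3 : ∑ v ∈ T \ S, (g S - g (S.erase (h v))) ≤ ∑ u ∈ S \ T, (g S - g (S.erase u)) := by
    rw [← Finset.sum_image (f := fun u => g S - g (S.erase u)) hinj]
    refine Finset.sum_le_sum_of_subset_of_nonneg (Finset.image_subset_iff.2 hmem) fun u _ _ => ?_
    exact sub_nonneg.2 (hg.mono _ _ (Finset.erase_subset _ _))
  have h4 := Finset.sum_sub_distrib (s := T \ S) (fun v => g (insert v S) - g S)
    fun v => g S - g (S.erase (h v))
  rw [exchangeGain, h1, h2]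
  linarith

end IsMonotoneSubmodular

end LocalOptimality

/-! ### Runs of a local search. -/

/-- The course of a local search on an arbitrary ground set. -/
def IsExchangeRun {X : Type*} [DecidableEq X] (g : Finset X → ℝ) (M : Matroid X)
    (L : List (Finset X)) : Prop :=
  L ≠ [] ∧ (∀ S ∈ L, M.IsBase (S : Set X)) ∧
    L.IsChain fun S S' => (∃ p ∈ S, ∃ q, q ∉ S ∧ S' = insert q (S.erase p)) ∧ g S ≤ g S'

namespace IsExchangeRun

variable {X : Type*} [DecidableEq X] {g : Finset X → ℝ} {M : Matroid X} {L : List (Finset X)}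

theorem singleton {S : Finset X} (hS : M.IsBase (S : Set X)) : IsExchangeRun g M [S] :=
  ⟨by simp, by simpa using hS, by simp⟩

theorem isBase (h : IsExchangeRun g M L) : M.IsBase (L.getLastD ∅ : Set X) := by
  obtain ⟨L', S, rfl⟩ := (List.eq_nil_or_concat L).resolve_left h.1
  exact h.2.1 _ (by simp)

theorem concat (h : IsExchangeRun g M L) {u v : X} (hu : u ∈ L.getLastD ∅)
    (hv : v ∉ L.getLastD ∅)
    (hB : M.IsBase ((insert v ((L.getLastD ∅).erase u) : Finset X) : Set X))
    (hle : g (L.getLastD ∅) ≤ g (insert v ((L.getLastD ∅).erase u))) :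
    IsExchangeRun g M (L ++ [insert v ((L.getLastD ∅).erase u)]) := by
  refine ⟨by simp, ?_, ?_⟩
  · intro S hS
    rcases List.mem_append.1 hS with hS | hS
    · exact h.2.1 S hS
    · rw [List.mem_singleton.1 hS]
      exact hB
  · refine List.isChain_append.2 ⟨h.2.2, by simp, ?_⟩
    intro a ha b hb
    have ha' : a = L.getLastD ∅ := by
      rw [List.getLastD_eq_getLast?, Option.mem_def.1 ha]
      rfl
    have hb' : b = insert v ((L.getLastD ∅).erase u) := by simpa using hb.symm
    subst ha' hb'
    exact ⟨⟨u, hu, v, hv, rfl⟩, hle⟩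

end IsExchangeRun

/-! ### One step: best exchange partners by sorting and binary search. -/

namespace QueryAlg

variable {X : Type*} [DecidableEq X]

/-- The sets whose independence decides which element of `us` is removed when `v` enters `S`. -/
def probe (S : Finset X) (us : List X) (v : X) : ℕ → Finset X
  -- An independent sentinel: when even removing all of `us` makes no room for `v`, the search still
  -- has an independent left end.
  | 0 => ∅
  | j + 1 => insert v (S \ (us.drop j).toFinset)

/-- Find the last element of `us` that can be exchanged for `v`. -/
def findPartner (S : Finset X) (us : List X) (v : X) : QueryAlg X (Option X) :=
  (search (probe S us v) (Nat.log 2 us.length + 1) 0 (us.length + 1)).bind fun j =>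
    -- The search ends with probe `j - 1` independent and probe `j` dependent. For `j ≥ 2` these
    -- differ in `us[j - 2]`; `j = 1` means that `v` has no partner in `us`.
    ret (if 2 ≤ j then us[j - 2]? else none)

theorem findPartner_isDeterministic (S : Finset X) (us : List X) (v : X) :
    (findPartner S us v).IsDeterministic :=
  (search_isDeterministic _ _ _ _).bind fun _ => trivial

theorem queries_findPartner (f : Finset X → ℝ) (I : Finset X → Bool) (S : Finset X)
    (us : List X) (v : X) : (findPartner S us v).queries f I ≤ Nat.log 2 us.length + 1 :=
  queries_bind_le (c := 0) f I (queries_search f I _ _ _ _) fun _ _ => le_rfl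

/-- Since `us` is sorted by `w`, the last exchangeable element is one with the largest `w`. -/
theorem findPartner_spec [Fintype X] (f : Finset X → ℝ) {M : Matroid X} {S : Finset X}
    {us : List X} {v : X} {o : Option X} {w : X → ℝ} (hS : M.IsBase (S : Set X)) (hv : v ∉ S)
    (hus : ∀ u ∈ us, u ∈ S) (hw : us.Pairwise fun a b => w a ≤ w b)
    (ho : o ∈ (findPartner S us v).outputs f (indepOracle M)) :
    (∀ u, o = some u → u ∈ us ∧ M.IsBase ((insert v (S.erase u) : Finset X) : Set X)) ∧
      ∀ u' ∈ us, M.IsBase ((insert v (S.erase u') : Finset X) : Set X) →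
        ∃ u, o = some u ∧ w u' ≤ w u := by
  obtain ⟨j, hj, ho⟩ := (mem_outputs_bind _ _).1 ho
  obtain ⟨i, rfl, hi, h1, h2⟩ := search_spec f _ _ (Nat.succ_pos _)
    (by simpa using Nat.lt_pow_succ_log_self one_lt_two us.length)
    (by simp [indepOracle, probe])
    (by
      have : probe S us v (us.length + 1) = insert v S := by simp [probe]
      rw [this, indepOracle, decide_eq_false_iff_not]
      exact not_indep_insert hS hv) hj
  simp only [indepOracle, decide_eq_true_eq, decide_eq_false_iff_not] at h1 h2
  -- For `u'` beyond the turning point, `S - u' + v` contains the dependent probe.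
  have hlater : ∀ u' ∈ us.drop i, ¬ M.IsBase ((insert v (S.erase u') : Finset X) : Set X) := by
    intro u' hu' hB
    refine h2 (hB.indep.subset ?_)
    have : S \ (us.drop i).toFinset ⊆ S.erase u' := fun x hx => by
      simp only [Finset.mem_sdiff, List.mem_toFinset] at hx
      exact Finset.mem_erase.2 ⟨fun h => hx.2 (h ▸ hu'), hx.1⟩
    exact_mod_cast Finset.insert_subset_insert v this
  simp only [outputs, Set.mem_singleton_iff] at ho
  subst ho
  rcases i with _ | i
  · simp only [zero_add, Nat.not_ofNat_le_one, if_false, reduceCtorEq, false_imp_iff,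
      implies_true, true_and]
    exact fun u' hu' hB => absurd hB (hlater u' (by simpa using hu'))
  · have hi' : i < us.length := by omega
    have hget : us[i + 1 + 1 - 2]? = some us[i] := by simp [hi']
    rw [if_pos (by omega), hget]
    have hmem : us[i] ∈ us := List.getElem_mem _
    refine ⟨?_, ?_⟩
    · rintro u hu
      obtain rfl : us[i] = u := Option.some_injective _ hu
      refine ⟨hmem, ?_⟩
      simp only [probe] at h1 h2
      -- A base between the independent probe and `S + v` omits `us[i]`, for otherwise it would
      -- contain the next, dependent probe.
      obtain ⟨B, hB, hQB, hBS⟩ := h1.exists_isBase_subset_union_isBase hS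
      refine isBase_insert_erase_of_subset hS hB ?_ hv (hus _ hmem) fun huB => h2 ?_
      · refine hBS.trans (Set.union_subset ?_ (Set.subset_insert _ _))
        rw [Finset.coe_insert]
        exact Set.insert_subset_insert (by exact_mod_cast Finset.sdiff_subset)
      · refine hB.indep.subset fun x hx => ?_
        simp only [Finset.coe_insert, Finset.coe_sdiff, Set.mem_insert_iff, Set.mem_sdiff,
          Finset.mem_coe, List.mem_toFinset] at hx
        rcases hx with rfl | ⟨hxS, hx⟩
        · exact hQB (by simp)
        · by_cases hxu : x = us[i]
          · exact hxu ▸ huB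
          · refine hQB ?_
            have hxd : x ∉ us.drop i := by
              rw [List.drop_eq_getElem_cons hi', List.mem_cons, not_or]
              exact ⟨hxu, hx⟩
            simp [hxS, hxd]
    · intro u' hu' hB
      refine ⟨_, rfl, ?_⟩
      have hu1 : u' ∉ us.drop (i + 1) := fun h => hlater u' h hB
      obtain ⟨k, hk, rfl⟩ := List.getElem_of_mem hu'
      have hki : k ≤ i := by
        by_contra! hlt
        apply hu1
        rw [List.mem_drop_iff_getElem]
        exact ⟨k - (i + 1), by omega, by congr 1; omega⟩
      rcases hki.eq_or_lt with rfl | hlt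
      · exact le_rfl
      · exact List.pairwise_iff_getElem.1 hw k i hk hi' hlt

/-- Find exchange partners in `us` for a list of entering elements. -/
def partners (S : Finset X) (us : List X) : List X → QueryAlg X (List (X × X))
  | [] => ret []
  | v :: vs => (findPartner S us v).bind fun o => (partners S us vs).bind fun ps =>
      ret (o.elim ps fun u => (u, v) :: ps)

theorem partners_isDeterministic (S : Finset X) (us vs : List X) :
    (partners S us vs).IsDeterministic := by
  induction vs with
  | nil => trivial
  | cons v vs ih => exact (findPartner_isDeterministic S us v).bind fun _ => ih.bind fun _ => trivial

theorem queries_partners (f : Finset X → ℝ) (I : Finset X → Bool) (S : Finset X)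
    (us vs : List X) :
    (partners S us vs).queries f I ≤ vs.length * (Nat.log 2 us.length + 1) := by
  induction vs with
  | nil => exact Nat.zero_le _
  | cons v vs ih =>
    rw [List.length_cons, add_mul, one_mul, add_comm]
    exact queries_bind_le f I (queries_findPartner f I S us v) fun _ _ =>
      queries_bind_le (c := 0) f I ih fun _ _ => le_rfl

theorem partners_spec [Fintype X] (f : Finset X → ℝ) {M : Matroid X} {S : Finset X}
    {us vs : List X} {ps : List (X × X)} {w : X → ℝ} (hS : M.IsBase (S : Set X))
    (hvs : ∀ v ∈ vs, v ∉ S) (hus : ∀ u ∈ us, u ∈ S) (hw : us.Pairwise fun a b => w a ≤ w b)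
    (hps : ps ∈ (partners S us vs).outputs f (indepOracle M)) :
    (∀ p ∈ ps, p.1 ∈ us ∧ p.2 ∈ vs ∧
        M.IsBase ((insert p.2 (S.erase p.1) : Finset X) : Set X)) ∧
      ∀ u' ∈ us, ∀ v ∈ vs, M.IsBase ((insert v (S.erase u') : Finset X) : Set X) →
        ∃ u, (u, v) ∈ ps ∧ w u' ≤ w u := by
  induction vs generalizing ps with
  | nil =>
    simp only [partners, outputs, Set.mem_singleton_iff] at hps
    simp [hps]
  | cons v vs ih =>
    obtain ⟨o, ho, hps⟩ := (mem_outputs_bind _ _).1 hps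
    obtain ⟨qs, hqs, hps⟩ := (mem_outputs_bind _ _).1 hps
    simp only [outputs, Set.mem_singleton_iff] at hps
    obtain ⟨h1, h2⟩ := findPartner_spec f hS (hvs v (by simp)) hus hw ho
    obtain ⟨h3, h4⟩ := ih (fun v hv => hvs v (List.mem_cons_of_mem _ hv)) hqs
    have hsub : qs ⊆ ps := by
      subst hps
      cases o <;> simp
    refine ⟨?_, ?_⟩
    · intro p hp
      have : p ∈ qs ∨ ∃ u, o = some u ∧ p = (u, v) := by
        subst hps
        cases o with
        | none => exact Or.inl hp
        | some u =>
          rcases List.mem_cons.1 hp with hp | hp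
          · exact Or.inr ⟨u, rfl, hp⟩
          · exact Or.inl hp
      rcases this with hp | ⟨u, hu, rfl⟩
      · exact ⟨(h3 p hp).1, List.mem_cons_of_mem _ (h3 p hp).2.1, (h3 p hp).2.2⟩
      · exact ⟨(h1 u hu).1, by simp, (h1 u hu).2⟩
    · intro u' hu' v' hv' hB
      rcases List.mem_cons.1 hv' with rfl | hv'
      · obtain ⟨u, rfl, hu⟩ := h2 u' hu' hB
        exact ⟨u, by simp [hps], hu⟩
      · obtain ⟨u, hu, hle⟩ := h4 u' hu' v' hv' hB
        exact ⟨u, hsub hu, hle⟩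

/-- The elements of `R`, sorted by `w`. -/
noncomputable def sortBy (w : X → ℝ) (R : Finset X) : List X :=
  R.toList.insertionSort fun a b => w a ≤ w b

omit [DecidableEq X] in
theorem mem_sortBy {w : X → ℝ} {R : Finset X} {u : X} : u ∈ sortBy w R ↔ u ∈ R := by
  simp [sortBy]

omit [DecidableEq X] in
theorem length_sortBy (w : X → ℝ) (R : Finset X) : (sortBy w R).length = R.card := by
  simp [sortBy]

omit [DecidableEq X] in
theorem pairwise_sortBy (w : X → ℝ) (R : Finset X) :
    (sortBy w R).Pairwise fun a b => w a ≤ w b := by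
  have : Std.Total fun a b => w a ≤ w b := ⟨fun a b => le_total _ _⟩
  have : IsTrans X fun a b => w a ≤ w b := ⟨fun a b c => le_trans⟩
  exact List.pairwise_insertionSort _ _

/-- A lower bound, by submodularity, for the gain of exchanging `p.1` for `p.2`. -/
def pairGain (F : Finset X → ℝ) (S : Finset X) (p : X × X) : ℝ :=
  F (insert p.2 S) - F S - (F S - F (S.erase p.1))

/-- Extend the run `L` by the most promising exchange, if there is one; the first component is
the guaranteed gain. -/
noncomputable def extendRun (F : Finset X → ℝ) (L : List (Finset X)) (ps : List (X × X)) :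
    ℝ × List (Finset X) :=
  (ps.argmax (pairGain F (L.getLastD ∅))).elim (0, L) fun p =>
    if 0 ≤ pairGain F (L.getLastD ∅) p then
      (pairGain F (L.getLastD ∅) p, L ++ [insert p.2 ((L.getLastD ∅).erase p.1)])
    else (0, L)

/-- One step of the local search, in which only elements of `R₁` leave and only elements of `R₂`
enter. -/
noncomputable def step (L : List (Finset X)) (R₁ R₂ : Finset X) :
    QueryAlg X (ℝ × List (Finset X)) :=
  (readValues (L.getLastD ∅ :: (R₁.toList.map (L.getLastD ∅).erase ++
      R₂.toList.map fun v => insert v (L.getLastD ∅)))).bind fun F =>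
    (partners (L.getLastD ∅) (sortBy (fun u => F ((L.getLastD ∅).erase u)) R₁)
      (R₂ \ L.getLastD ∅).toList).bind fun ps => ret (extendRun F L ps)

theorem step_isDeterministic (L : List (Finset X)) (R₁ R₂ : Finset X) :
    (step L R₁ R₂).IsDeterministic :=
  (readValues_isDeterministic _).bind fun _ => (partners_isDeterministic _ _ _).bind fun _ => trivial

theorem queries_step (f : Finset X → ℝ) (I : Finset X → Bool) (L : List (Finset X))
    (R₁ R₂ : Finset X) : (step L R₁ R₂).queries f I ≤
      (R₁.card + R₂.card + 1) + R₂.card * (Nat.log 2 R₁.card + 1) := by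
  refine queries_bind_le f I ((queries_readValues _ _ _).trans (by simp)) fun F _ => ?_
  refine queries_bind_le (a := R₂.card * (Nat.log 2 R₁.card + 1)) (c := 0) f I
    ((queries_partners _ _ _ _ _).trans ?_) fun _ _ => le_rfl
  rw [length_sortBy, Finset.length_toList]
  exact Nat.mul_le_mul_right _ (Finset.card_le_card Finset.sdiff_subset)

/-- The marginal of `v` over `S - u` is at least its marginal over `S`. The resulting bound depends
on `u` only through `g (S.erase u)`, which is what makes sorting suffice. -/
theorem _root_.IsMonotoneSubmodular.add_pairGain_le {g : Finset X → ℝ}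
    (hg : IsMonotoneSubmodular g) {S : Finset X} (u : X) {v : X} (hv : v ∉ S) :
    g S + pairGain g S (u, v) ≤ g (insert v (S.erase u)) := by
  have := hg.marginal_anti (Finset.erase_subset u S) hv
  simp only [pairGain]
  linarith

theorem step_spec [Fintype X] {g : Finset X → ℝ} (hg : IsMonotoneSubmodular g) {M : Matroid X}
    {L : List (Finset X)} (hL : IsExchangeRun g M L) {R₁ R₂ : Finset X}
    (hR : R₁ ⊆ L.getLastD ∅) {r : ℝ × List (Finset X)}
    (hr : r ∈ (step L R₁ R₂).outputs g (indepOracle M)) :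
    IsExchangeRun g M r.2 ∧ 0 ≤ r.1 ∧ g (L.getLastD ∅) + r.1 ≤ g (r.2.getLastD ∅) ∧
      ∀ u ∈ R₁, ∀ v ∈ R₂, v ∉ L.getLastD ∅ →
        M.IsBase ((insert v ((L.getLastD ∅).erase u) : Finset X) : Set X) →
          pairGain g (L.getLastD ∅) (u, v) ≤ r.1 := by
  obtain ⟨F, hF, hr⟩ := (mem_outputs_bind _ _).1 hr
  obtain ⟨ps, hps, hr⟩ := (mem_outputs_bind _ _).1 hr
  rw [outputs_readValues, Set.mem_singleton_iff] at hF
  simp only [outputs, Set.mem_singleton_iff] at hr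
  have hbase := hL.isBase
  obtain ⟨h1, h2⟩ := partners_spec g hbase (fun v hv => (Finset.mem_sdiff.1 (Finset.mem_toList.1 hv)).2)
    (fun u hu => hR (mem_sortBy.1 hu)) (pairwise_sortBy _ _) hps
  have hFg : ∀ u ∈ R₁, ∀ v ∈ R₂, pairGain F (L.getLastD ∅) (u, v) =
      pairGain g (L.getLastD ∅) (u, v) := by
    intro u hu v hv
    have hFS : F (L.getLastD ∅) = g (L.getLastD ∅) := by
      rw [hF]
      exact table_of_mem g List.mem_cons_self
    have hFu : F ((L.getLastD ∅).erase u) = g ((L.getLastD ∅).erase u) := by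
      rw [hF]
      exact table_of_mem g (List.mem_cons_of_mem _ (List.mem_append_left _
        (List.mem_map.2 ⟨u, Finset.mem_toList.2 hu, rfl⟩)))
    have hFv : F (insert v (L.getLastD ∅)) = g (insert v (L.getLastD ∅)) := by
      rw [hF]
      exact table_of_mem g (List.mem_cons_of_mem _ (List.mem_append_right _
        (List.mem_map.2 ⟨v, Finset.mem_toList.2 hv, rfl⟩)))
    simp only [pairGain, hFS, hFu, hFv]
  have hmem : ∀ p ∈ ps, p.1 ∈ R₁ ∧ p.2 ∈ R₂ ∧ p.2 ∉ L.getLastD ∅ ∧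
      M.IsBase ((insert p.2 ((L.getLastD ∅).erase p.1) : Finset X) : Set X) := by
    intro p hp
    obtain ⟨ha, hb, hc⟩ := h1 p hp
    rw [Finset.mem_toList, Finset.mem_sdiff] at hb
    exact ⟨mem_sortBy.1 ha, hb.1, hb.2, hc⟩
  -- For fixed `v`, a partner with larger `F (S.erase u)` has larger `pairGain`, so the one pair
  -- kept per `v` dominates all others.
  have hcover : ∀ u ∈ R₁, ∀ v ∈ R₂, v ∉ L.getLastD ∅ →
      M.IsBase ((insert v ((L.getLastD ∅).erase u) : Finset X) : Set X) →
        ∃ p ∈ ps, pairGain g (L.getLastD ∅) (u, v) ≤ pairGain F (L.getLastD ∅) p := by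
    intro u hu v hv hvS hB
    obtain ⟨u', hu', hle⟩ := h2 u (mem_sortBy.2 hu) v
      (by rw [Finset.mem_toList, Finset.mem_sdiff]; exact ⟨hv, hvS⟩) hB
    refine ⟨_, hu', ?_⟩
    rw [← hFg u hu v hv]
    simp only [pairGain]
    linarith
  subst hr
  unfold extendRun
  cases hmax : ps.argmax (pairGain F (L.getLastD ∅)) with
  | none =>
    refine ⟨hL, le_rfl, by simp, fun u hu v hv hvS hB => ?_⟩
    obtain ⟨p, hp, -⟩ := hcover u hu v hv hvS hB
    rw [List.argmax_eq_none.1 hmax] at hp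
    simp at hp
  | some p =>
    have hp := hmem p (List.argmax_mem hmax)
    have hle : ∀ u ∈ R₁, ∀ v ∈ R₂, v ∉ L.getLastD ∅ →
        M.IsBase ((insert v ((L.getLastD ∅).erase u) : Finset X) : Set X) →
          pairGain g (L.getLastD ∅) (u, v) ≤ pairGain F (L.getLastD ∅) p := by
      intro u hu v hv hvS hB
      obtain ⟨q, hq, hle⟩ := hcover u hu v hv hvS hB
      exact hle.trans (List.le_of_mem_argmax hq hmax)
    simp only [Option.elim_some]
    split_ifs with h0
    · have hadd := hg.add_pairGain_le p.1 hp.2.2.1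
      rw [← hFg _ hp.1 _ hp.2.1] at hadd
      exact ⟨hL.concat (hR hp.1) hp.2.2.1 hp.2.2.2 (by linarith), h0, by simpa using hadd, hle⟩
    · exact ⟨hL, le_rfl, by simp, fun u hu v hv hvS hB => (hle u hu v hv hvS hB).trans
        (not_le.1 h0).le⟩

end QueryAlg

/-! ### The deterministic local search. -/

namespace QueryAlg

variable {X : Type*} [Fintype X] [DecidableEq X]

theorem exchangeGain_le_card_mul {g : Finset X → ℝ} (hg : IsMonotoneSubmodular g) {M : Matroid X}
    {S T : Finset X} (hS : M.IsBase (S : Set X)) (hT : M.Indep (T : Set X)) {m : ℝ} (hm : 0 ≤ m)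
    (h : ∀ u ∈ S, ∀ v, v ∉ S → M.IsBase ((insert v (S.erase u) : Finset X) : Set X) →
      pairGain g S (u, v) ≤ m) :
    exchangeGain g S T ≤ S.card * m := by
  obtain ⟨φ, hinj, hφ⟩ := exists_exchange_injection hS hT
  refine (hg.exchangeGain_le hinj fun v hv => (hφ v hv).1).trans ?_
  calc _ ≤ ∑ _v ∈ T \ S, m := Finset.sum_le_sum fun v hv =>
        h _ (Finset.mem_sdiff.1 (hφ v hv).1).1 v (Finset.mem_sdiff.1 hv).2 (hφ v hv).2
    _ = (T \ S).card * m := by simp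
    _ ≤ S.card * m := by
        have := (Finset.card_le_card (Finset.sdiff_subset (s := T) (t := S))).trans
          (card_le_of_indep hS hT)
        exact mul_le_mul_of_nonneg_right (by exact_mod_cast this) hm

/-- Make `k + 1` steps of the local search with all elements and return the part of the run
before the step with the smallest guaranteed gain, together with this gain. -/
noncomputable def bestPrefix : ℕ → List (Finset X) → QueryAlg X (ℝ × List (Finset X))
  | 0, L => (step L (L.getLastD ∅) Finset.univ).bind fun r => ret (r.1, L)
  | k + 1, L => (step L (L.getLastD ∅) Finset.univ).bind fun r =>
      (bestPrefix k r.2).bind fun q => ret (if r.1 ≤ q.1 then (r.1, L) else q)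

theorem bestPrefix_isDeterministic (k : ℕ) (L : List (Finset X)) :
    (bestPrefix k L).IsDeterministic := by
  induction k generalizing L with
  | zero => exact (step_isDeterministic _ _ _).bind fun _ => trivial
  | succ k ih => exact (step_isDeterministic _ _ _).bind fun _ => (ih _).bind fun _ => trivial

/-- The gains of the `k + 1` steps telescope below `G`, so `k + 1` times the smallest one fits as
well. At the set where that step was taken, no exchange promises more than this gain. -/
theorem bestPrefix_spec {g : Finset X → ℝ} (hg : IsMonotoneSubmodular g) {M : Matroid X} {G : ℝ}
    (hG : ∀ T : Finset X, M.Indep (T : Set X) → g T ≤ G) {k : ℕ} {L : List (Finset X)}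
    (hL : IsExchangeRun g M L) {q : ℝ × List (Finset X)}
    (hq : q ∈ (bestPrefix k L).outputs g (indepOracle M)) :
    IsExchangeRun g M q.2 ∧ 0 ≤ q.1 ∧
      (∀ T : Finset X, M.Indep (T : Set X) →
        exchangeGain g (q.2.getLastD ∅) T ≤ (q.2.getLastD ∅).card * q.1) ∧
      (k + 1) * q.1 + g (L.getLastD ∅) ≤ G := by
  have key : ∀ r ∈ (step L (L.getLastD ∅) Finset.univ).outputs g (indepOracle M),
      IsExchangeRun g M r.2 ∧ 0 ≤ r.1 ∧ g (L.getLastD ∅) + r.1 ≤ g (r.2.getLastD ∅) ∧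
      ∀ T : Finset X, M.Indep (T : Set X) →
        exchangeGain g (L.getLastD ∅) T ≤ (L.getLastD ∅).card * r.1 := by
    intro r hr
    obtain ⟨h1, h2, h3, h4⟩ := step_spec hg hL subset_rfl hr
    exact ⟨h1, h2, h3, fun T hT => exchangeGain_le_card_mul hg hL.isBase hT h2
      fun u hu v hv hB => h4 u hu v (Finset.mem_univ v) hv hB⟩
  induction k generalizing L q with
  | zero =>
    obtain ⟨r, hr, hq⟩ := (mem_outputs_bind _ _).1 hq
    simp only [outputs, Set.mem_singleton_iff] at hq
    obtain ⟨h1, h2, h3, h4⟩ := key r hr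
    subst hq
    refine ⟨hL, h2, h4, ?_⟩
    have := hG _ h1.isBase.indep
    simp only [Nat.cast_zero]
    linarith
  | succ k ih =>
    obtain ⟨r, hr, hq⟩ := (mem_outputs_bind _ _).1 hq
    obtain ⟨q', hq', hq⟩ := (mem_outputs_bind _ _).1 hq
    simp only [outputs, Set.mem_singleton_iff] at hq
    obtain ⟨h1, h2, h3, h4⟩ := key r hr
    obtain ⟨i1, i2, i3, i4⟩ := ih h1 hq' (by
      intro r' hr'
      obtain ⟨h1, h2, h3, h4⟩ := step_spec hg h1 subset_rfl hr'
      exact ⟨h1, h2, h3, fun T hT => exchangeGain_le_card_mul hg ‹IsExchangeRun g M r.2›.isBase hT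
        h2 fun u hu v hv hB => h4 u hu v (Finset.mem_univ v) hv hB⟩)
    push_cast
    split_ifs at hq with hle
    · subst hq
      refine ⟨hL, h2, h4, ?_⟩
      have : ((k : ℝ) + 1) * r.1 ≤ (k + 1) * q'.1 := by gcongr
      simp only
      linarith
    · subst hq
      refine ⟨i1, i2, i3, ?_⟩
      rw [not_le] at hle
      linarith

theorem queries_bestPrefix_le {g : Finset X → ℝ} (hg : IsMonotoneSubmodular g) {M : Matroid X}
    {ρ : ℕ} (hρ : ∀ B : Finset X, M.IsBase (B : Set X) → B.card ≤ ρ) (k : ℕ) {L : List (Finset X)}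
    (hL : IsExchangeRun g M L) : (bestPrefix k L).queries g (indepOracle M) ≤
      (k + 1) * ((ρ + Fintype.card X + 1) + Fintype.card X * (Nat.log 2 ρ + 1)) := by
  have key : ∀ L, IsExchangeRun g M L →
      (step L (L.getLastD ∅) Finset.univ).queries g (indepOracle M) ≤
        (ρ + Fintype.card X + 1) + Fintype.card X * (Nat.log 2 ρ + 1) := by
    intro L hL
    have := hρ _ hL.isBase
    refine (queries_step _ _ _ _ _).trans ?_
    rw [Finset.card_univ]
    gcongr
  induction k generalizing L with
  | zero =>
    rw [zero_add, one_mul]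
    exact queries_bind_le (c := 0) _ _ (key L hL) fun _ _ => le_rfl
  | succ k ih =>
    rw [add_mul (k + 1), one_mul, Nat.add_comm (_ * _)]
    refine queries_bind_le _ _ (key L hL) fun r hr => ?_
    exact queries_bind_le (a := (k + 1) * _) (c := 0) _ _
      (ih (step_spec hg hL subset_rfl hr).1) fun _ _ => le_rfl

/-- The deterministic local search. -/
noncomputable def detSearch (X : Type*) [Fintype X] [DecidableEq X] (K : ℕ) :
    QueryAlg X (List (Finset X)) :=
  (greedyBase Finset.univ.toList ∅).bind fun B =>
    (bestPrefix (B.card * K) [B]).bind fun q => ret q.2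

theorem detSearch_isDeterministic (K : ℕ) : (detSearch X K).IsDeterministic :=
  (greedyBase_isDeterministic _ _).bind fun _ => (bestPrefix_isDeterministic _ _).bind fun _ =>
    trivial

/-- Taking `B.card * K` as the step parameter cancels the factor `B.card` by which the violation may
exceed the gain of the best exchange. -/
theorem detSearch_spec {g : Finset X → ℝ} (hg : IsMonotoneSubmodular g) {M : Matroid X} (K : ℕ)
    {G : ℝ} (hG : ∀ T : Finset X, M.Indep (T : Set X) → g T ≤ G) {L : List (Finset X)}
    (hL : L ∈ (detSearch X K).outputs g (indepOracle M)) :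
    IsExchangeRun g M L ∧
      ∀ T : Finset X, M.Indep (T : Set X) → K * exchangeGain g (L.getLastD ∅) T ≤ G := by
  obtain ⟨B, hB, hL⟩ := (mem_outputs_bind _ _).1 hL
  obtain ⟨q, hq, hL⟩ := (mem_outputs_bind _ _).1 hL
  simp only [outputs, Set.mem_singleton_iff] at hL
  subst hL
  have hBase := isBase_of_mem_outputs_greedyBase _ g M (by simp) hB
  obtain ⟨h1, h2, h3, h4⟩ := bestPrefix_spec hg hG (.singleton hBase) hq
  refine ⟨h1, fun T hT => ?_⟩
  have hcard : (q.2.getLastD ∅).card = B.card :=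
    (card_le_of_indep hBase h1.isBase.indep).antisymm (card_le_of_indep h1.isBase hBase.indep)
  have h5 := h3 T hT
  rw [hcard] at h5
  have h6 : (K : ℝ) * exchangeGain g (q.2.getLastD ∅) T ≤ K * (B.card * q.1) := by gcongr
  have h7 := hg.nonneg ([B].getLastD ∅)
  push_cast at h4
  linarith

theorem queries_detSearch_le {g : Finset X → ℝ} (hg : IsMonotoneSubmodular g) {M : Matroid X}
    (K : ℕ) {ρ : ℕ} (hρ : ∀ B : Finset X, M.IsBase (B : Set X) → B.card ≤ ρ) :
    (detSearch X K).queries g (indepOracle M) ≤ Fintype.card X +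
      (ρ * K + 1) * ((ρ + Fintype.card X + 1) + Fintype.card X * (Nat.log 2 ρ + 1)) := by
  refine queries_bind_le _ _ (by simp [queries_greedyBase]) fun B hB => ?_
  have hBase := isBase_of_mem_outputs_greedyBase _ g M (by simp) hB
  refine queries_bind_le (a := (ρ * K + 1) * _) (c := 0) _ _
    ((queries_bestPrefix_le hg hρ _ (.singleton hBase)).trans ?_) fun _ _ => le_rfl
  gcongr
  exact hρ B hBase

end QueryAlg

/-! ### Uniformly random subsets and the expected best reward. -/

section Sampling

variable {X : Type*} [DecidableEq X]

theorem Finset.filter_mem_powersetCard_succ {A : Finset X} {u : X} (hu : u ∈ A) (s : ℕ) :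
    (A.powersetCard (s + 1)).filter (u ∈ ·) = ((A.erase u).powersetCard s).image (insert u) := by
  ext R
  simp only [Finset.mem_filter, Finset.mem_powersetCard, Finset.mem_image]
  constructor
  · rintro ⟨⟨hRA, hcard⟩, huR⟩
    refine ⟨R.erase u, ⟨Finset.erase_subset_erase _ hRA, ?_⟩, Finset.insert_erase huR⟩
    rw [Finset.card_erase_of_mem huR, hcard, Nat.add_sub_cancel]
  · rintro ⟨R, ⟨hRA, hcard⟩, rfl⟩
    have huR : u ∉ R := fun h => by simpa using hRA h
    refine ⟨⟨Finset.insert_subset hu (hRA.trans (Finset.erase_subset _ _)), ?_⟩, by simp⟩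
    rw [Finset.card_insert_of_notMem huR, hcard]

theorem Finset.card_mul_card_filter_mem_powersetCard {A : Finset X} {u : X} (hu : u ∈ A)
    (s : ℕ) : A.card * ((A.powersetCard s).filter (u ∈ ·)).card = s * A.card.choose s := by
  obtain ⟨a, ha⟩ : ∃ a, A.card = a + 1 := ⟨A.card - 1, by
    have := Finset.card_pos.2 ⟨u, hu⟩
    omega⟩
  rcases s with _ | s
  · simp
  · have hinj : Set.InjOn (insert u) ((A.erase u).powersetCard s : Set (Finset X)) := by
      intro R hR R' hR' h
      have h1 : u ∉ R := fun h => by simpa using (Finset.mem_powersetCard.1 hR).1 h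
      have h2 : u ∉ R' := fun h => by simpa using (Finset.mem_powersetCard.1 hR').1 h
      rw [← Finset.erase_insert h1, ← Finset.erase_insert h2]
      exact congrArg (Finset.erase · u) h
    rw [Finset.filter_mem_powersetCard_succ hu, Finset.card_image_of_injOn hinj,
      Finset.card_powersetCard, Finset.card_erase_of_mem hu, ha, Nat.add_sub_cancel,
      Nat.add_one_mul_choose_eq, mul_comm]

theorem Finset.card_mul_card_filter_mem_mem_powersetCard {A : Finset X} {u v : X} (hu : u ∈ A)
    (hv : v ∈ A) (huv : u ≠ v) (s : ℕ) :
    A.card * ((A.card - 1) * ((A.powersetCard s).filter fun R => u ∈ R ∧ v ∈ R).card) =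
      s * ((s - 1) * A.card.choose s) := by
  obtain ⟨a, ha⟩ : ∃ a, A.card = a + 1 := ⟨A.card - 1, by
    have := Finset.card_pos.2 ⟨u, hu⟩
    omega⟩
  rcases s with _ | s
  · simp [Finset.filter_singleton]
  · have hinj : Set.InjOn (insert u) ((A.erase u).powersetCard s : Set (Finset X)) := by
      intro R hR R' hR' h
      have h1 : u ∉ R := fun h => by simpa using (Finset.mem_powersetCard.1 hR).1 h
      have h2 : u ∉ R' := fun h => by simpa using (Finset.mem_powersetCard.1 hR').1 h
      rw [← Finset.erase_insert h1, ← Finset.erase_insert h2]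
      exact congrArg (Finset.erase · u) h
    have hv' : v ∈ A.erase u := Finset.mem_erase.2 ⟨huv.symm, hv⟩
    have h1 := Finset.card_mul_card_filter_mem_powersetCard hv' s
    rw [← Finset.filter_filter, Finset.filter_mem_powersetCard_succ hu, Finset.filter_image,
      Finset.card_image_of_injOn (hinj.mono fun R hR => (Finset.mem_filter.1 hR).1)]
    simp only [Finset.mem_insert, huv.symm, false_or]
    rw [Finset.card_erase_of_mem hu] at h1
    rw [h1, ha, Nat.add_sub_cancel, Nat.add_sub_cancel]
    have := Nat.add_one_mul_choose_eq a s
    linear_combination s * this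

theorem Finset.sum_mem_powersetCard {A : Finset X} {u : X} (hu : u ∈ A) (s : ℕ) :
    ∑ R ∈ A.powersetCard s, (if u ∈ R then (1 : ℝ) else 0) =
      s / A.card * (A.powersetCard s).card := by
  have h := Finset.card_mul_card_filter_mem_powersetCard hu s
  have hA : (A.card : ℝ) ≠ 0 := by exact_mod_cast (Finset.card_pos.2 ⟨u, hu⟩).ne'
  rw [Finset.sum_boole, Finset.card_powersetCard]
  field_simp
  rw [mul_comm]
  exact_mod_cast h

/-- Sampling without replacement is negatively correlated: `(s - 1) / (a - 1) ≤ s / a` for `s ≤ a =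
A.card`. -/
theorem Finset.sum_mem_mem_powersetCard_le {A : Finset X} {u v : X} (hu : u ∈ A) (hv : v ∈ A)
    (huv : u ≠ v) {s : ℕ} (hs : s ≤ A.card) :
    ∑ R ∈ A.powersetCard s, (if u ∈ R then (1 : ℝ) else 0) * (if v ∈ R then 1 else 0) ≤
      (s / A.card) ^ 2 * (A.powersetCard s).card := by
  have h := Finset.card_mul_card_filter_mem_mem_powersetCard hu hv huv s
  have hlt : 1 < A.card := Finset.one_lt_card.2 ⟨u, hu, v, hv, huv⟩
  have hsum : ∀ R : Finset X, (if u ∈ R then (1 : ℝ) else 0) * (if v ∈ R then 1 else 0) =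
      if u ∈ R ∧ v ∈ R then 1 else 0 := by
    intro R
    split_ifs <;> simp_all
  simp only [hsum]
  rw [Finset.sum_boole, Finset.card_powersetCard]
  generalize ((A.powersetCard s).filter fun R => u ∈ R ∧ v ∈ R).card = c at h ⊢
  generalize A.card.choose s = d at h ⊢
  generalize A.card = a at h hlt hs ⊢
  obtain ⟨a, rfl⟩ : ∃ b, a = b + 1 := ⟨a - 1, by omega⟩
  rw [div_pow, div_mul_eq_mul_div, le_div_iff₀ (by positivity)]
  rcases s with _ | s
  · simp only [zero_mul, mul_eq_zero] at h
    have : c = 0 := by omega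
    simp [this]
  · simp only [Nat.add_sub_cancel] at h
    have ha : 0 < (a : ℝ) := by exact_mod_cast (by omega : 0 < a)
    have hs' : (s : ℝ) ≤ a := by exact_mod_cast (by omega : s ≤ a)
    have h' : ((a : ℝ) + 1) * (a * c) = (s + 1) * (s * d) := by exact_mod_cast h
    push_cast
    have h1 : (s : ℝ) * ((a + 1) * (s + 1) * d) ≤ a * ((s + 1) ^ 2 * d) := by
      have : (s : ℝ) * (a + 1) ≤ a * (s + 1) := by linarith
      calc (s : ℝ) * ((a + 1) * (s + 1) * d) = s * (a + 1) * ((s + 1) * d) := by ring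
        _ ≤ a * (s + 1) * ((s + 1) * d) := by gcongr
        _ = _ := by ring
    refine le_of_mul_le_mul_left (le_trans (le_of_eq ?_) h1) ha
    linear_combination ((a : ℝ) + 1) * h'

/-- If events have probability `p` and are pairwise at most as correlated as independent ones, then
the expected maximum of the rewards `a` of the events that occur is large. -/
theorem le_sum_of_pairwise {ι γ : Type*} [DecidableEq ι] (Ω : Finset γ) (V : Finset ι)
    (x : ι → γ → ℝ) (a : ι → ℝ) (m : γ → ℝ) {p : ℝ} (hx : ∀ v ∈ V, ∀ ω ∈ Ω, x v ω = 0 ∨ x v ω = 1)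
    (ha : ∀ v ∈ V, 0 ≤ a v) (h1 : ∀ v ∈ V, ∑ ω ∈ Ω, x v ω = p * Ω.card)
    (h2 : ∀ v ∈ V, ∀ w ∈ V, v ≠ w → ∑ ω ∈ Ω, x v ω * x w ω ≤ p ^ 2 * Ω.card)
    (hm : ∀ ω ∈ Ω, 0 ≤ m ω) (hxm : ∀ v ∈ V, ∀ ω ∈ Ω, x v ω = 1 → a v ≤ m ω) :
    p * (1 - V.card * p) * (∑ v ∈ V, a v) * Ω.card ≤ ∑ ω ∈ Ω, m ω := by
  -- A Bonferroni-type bound: fix an event `v` that occurs. Its own term is at most `a v ≤ m ω`, and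
  -- every other term is nonpositive, since its subtracted sum contains `x w ω * x v ω = x w ω`.
  have hpt : ∀ ω ∈ Ω, ∑ v ∈ V, a v * (x v ω - ∑ w ∈ V.erase v, x v ω * x w ω) ≤ m ω := by
    intro ω hω
    have hx0 : ∀ v ∈ V, 0 ≤ x v ω := fun v hv => by
      rcases hx v hv ω hω with h | h <;> simp [h]
    by_cases hex : ∃ v ∈ V, x v ω = 1
    · obtain ⟨v, hv, hv1⟩ := hex
      rw [← Finset.add_sum_erase V _ hv]
      have hr : ∀ w ∈ V.erase v, a w * (x w ω - ∑ y ∈ V.erase w, x w ω * x y ω) ≤ 0 := by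
        intro w hw
        refine mul_nonpos_of_nonneg_of_nonpos (ha w (Finset.mem_of_mem_erase hw)) ?_
        have hvw : v ∈ V.erase w := Finset.mem_erase.2 ⟨(Finset.ne_of_mem_erase hw).symm, hv⟩
        have := Finset.single_le_sum (f := fun y => x w ω * x y ω) (fun y hy =>
          mul_nonneg (hx0 w (Finset.mem_of_mem_erase hw)) (hx0 y (Finset.mem_of_mem_erase hy))) hvw
        simp only [hv1, mul_one] at this
        linarith
      have hle : a v * (x v ω - ∑ w ∈ V.erase v, x v ω * x w ω) ≤ a v := by
        refine mul_le_of_le_one_right (ha v hv) ?_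
        have : 0 ≤ ∑ w ∈ V.erase v, x v ω * x w ω := Finset.sum_nonneg fun w hw =>
          mul_nonneg (hx0 v hv) (hx0 w (Finset.mem_of_mem_erase hw))
        linarith
      linarith [Finset.sum_nonpos hr, hxm v hv ω hω hv1]
    · push Not at hex
      have h0 : ∀ v ∈ V, x v ω = 0 := fun v hv => (hx v hv ω hω).resolve_right (hex v hv)
      refine (Finset.sum_nonpos fun v hv => ?_).trans (hm ω hω)
      simp [h0 v hv]
  refine le_trans ?_ (Finset.sum_le_sum hpt)
  rw [Finset.sum_comm, Finset.mul_sum, Finset.sum_mul]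
  refine Finset.sum_le_sum fun v hv => ?_
  rw [← Finset.mul_sum, Finset.sum_sub_distrib, h1 v hv, Finset.sum_comm]
  have hb : ∑ w ∈ V.erase v, ∑ ω ∈ Ω, x v ω * x w ω ≤ V.card * (p ^ 2 * Ω.card) := by
    calc _ ≤ ∑ _w ∈ V.erase v, p ^ 2 * (Ω.card : ℝ) := Finset.sum_le_sum fun w hw =>
          h2 v hv w (Finset.mem_of_mem_erase hw) (Finset.ne_of_mem_erase hw).symm
      _ = (V.erase v).card * (p ^ 2 * Ω.card) := by simp
      _ ≤ _ := by
        gcongr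
        exact Finset.erase_subset _ _
  calc p * (1 - V.card * p) * a v * Ω.card
      = a v * (p * Ω.card - V.card * (p ^ 2 * Ω.card)) := by ring
    _ ≤ _ := mul_le_mul_of_nonneg_left (by linarith) (ha v hv)

theorem Finset.sum_product_mul {γ δ : Type*} (A : Finset γ) (B : Finset δ) (f : γ → ℝ)
    (h : δ → ℝ) : ∑ R ∈ A ×ˢ B, f R.1 * h R.2 = (∑ a ∈ A, f a) * ∑ b ∈ B, h b := by
  rw [Finset.sum_mul_sum, Finset.sum_product]

/-- The average reward of pairs of random subsets that is guaranteed by a matching `φ`. -/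
theorem le_sum_powersetCard_product [Fintype X] {S V : Finset X} {φ : X → X}
    (hinj : Set.InjOn φ (V : Set X)) (hφ : ∀ v ∈ V, φ v ∈ S) {s t : ℕ} (hs : s ≤ S.card)
    (ht : t ≤ Fintype.card X) {a : X → ℝ} (ha : ∀ v ∈ V, 0 ≤ a v) {m : Finset X × Finset X → ℝ}
    (hm : ∀ R ∈ S.powersetCard s ×ˢ (Finset.univ : Finset X).powersetCard t, 0 ≤ m R)
    (hxm : ∀ v ∈ V, ∀ R ∈ S.powersetCard s ×ˢ (Finset.univ : Finset X).powersetCard t,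
      φ v ∈ R.1 → v ∈ R.2 → a v ≤ m R) {p : ℝ} (hp : p = s / S.card * (t / Fintype.card X)) :
    p * (1 - V.card * p) * (∑ v ∈ V, a v) *
        (S.powersetCard s ×ˢ (Finset.univ : Finset X).powersetCard t).card ≤
      ∑ R ∈ S.powersetCard s ×ˢ (Finset.univ : Finset X).powersetCard t, m R := by
  refine le_sum_of_pairwise _ V
    (fun v R => (if φ v ∈ R.1 then 1 else 0) * (if v ∈ R.2 then 1 else 0)) a m
    (fun v _ R _ => by split_ifs <;> simp) ha ?_ ?_ hm ?_
  · intro v hv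
    rw [Finset.sum_product_mul _ _ (fun R => if φ v ∈ R then (1 : ℝ) else 0)
      (fun R => if v ∈ R then (1 : ℝ) else 0), Finset.sum_mem_powersetCard (hφ v hv),
      Finset.sum_mem_powersetCard (Finset.mem_univ v), Finset.card_univ, Finset.card_product, hp]
    push_cast
    ring
  -- The two samples are independent, so the joint probabilities factor; injectivity of `φ` makes
  -- the leaving elements distinct as well.
  · intro v hv w hw hvw
    have e1 := Finset.sum_mem_mem_powersetCard_le (hφ v hv) (hφ w hw)
      (fun h => hvw (hinj hv hw h)) hs
    have e2 := Finset.sum_mem_mem_powersetCard_le (Finset.mem_univ v) (Finset.mem_univ w) hvw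
      (s := t) (by simpa using ht)
    have e3 := Finset.sum_product_mul (S.powersetCard s) ((Finset.univ : Finset X).powersetCard t)
      (fun R => (if φ v ∈ R then (1 : ℝ) else 0) * (if φ w ∈ R then 1 else 0))
      (fun R => (if v ∈ R then (1 : ℝ) else 0) * (if w ∈ R then 1 else 0))
    rw [Finset.card_univ] at e2
    calc _ = _ := Finset.sum_congr rfl fun R _ => mul_mul_mul_comm _ _ _ _
      _ = _ := e3
      _ ≤ _ := mul_le_mul e1 e2 (Finset.sum_nonneg fun R _ => by positivity) (by positivity)
      _ = _ := by
        rw [Finset.card_product, hp]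
        push_cast
        ring
  · intro v hv R hR hx
    have hmem : φ v ∈ R.1 ∧ v ∈ R.2 := by
      by_contra hcon
      rw [not_and_or] at hcon
      rcases hcon with h | h <;> simp [h] at hx
    exact hxm v hv R hR hmem.1 hmem.2

end Sampling

/-! ### The largest violation of local optimality. -/

section MaxGain

variable {X : Type*} [Fintype X] [DecidableEq X]

/-- The amount by which `S` violates local optimality. -/
noncomputable def maxExchangeGain (g : Finset X → ℝ) (M : Matroid X) (S : Finset X) : ℝ :=
  ⨆ T : {T : Finset X // M.Indep (T : Set X)}, exchangeGain g S T

variable {g : Finset X → ℝ} {M : Matroid X} {S T : Finset X}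

theorem exchangeGain_le_max (hT : M.Indep (T : Set X)) :
    exchangeGain g S T ≤ maxExchangeGain g M S :=
  le_ciSup (f := fun T : {T : Finset X // M.Indep (T : Set X)} => exchangeGain g S T)
    (Set.finite_range _).bddAbove ⟨T, hT⟩

theorem exists_maxExchangeGain_eq (g : Finset X → ℝ) (M : Matroid X) (S : Finset X) :
    ∃ T : Finset X, M.Indep (T : Set X) ∧ exchangeGain g S T = maxExchangeGain g M S := by
  have : Nonempty {T : Finset X // M.Indep (T : Set X)} := ⟨⟨∅, by simp⟩⟩
  obtain ⟨T, hT⟩ := exists_eq_ciSup_of_finite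
    (f := fun T : {T : Finset X // M.Indep (T : Set X)} => exchangeGain g S T)
  exact ⟨T.1, T.2, hT⟩

theorem maxExchangeGain_nonneg (hS : M.Indep (S : Set X)) : 0 ≤ maxExchangeGain g M S :=
  (exchangeGain_self g S).symm.le.trans (exchangeGain_le_max hS)

/-- A crude bound, for the degenerate case `G = 0`, where Markov's inequality is unavailable. -/
theorem maxExchangeGain_le_card_mul (hg : IsMonotoneSubmodular g) {G : ℝ}
    (hG : ∀ T : Finset X, M.Indep (T : Set X) → g T ≤ G) (S : Finset X) :
    maxExchangeGain g M S ≤ Fintype.card X * G := by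
  obtain ⟨T, hT, hmax⟩ := exists_maxExchangeGain_eq g M S
  have hG0 : 0 ≤ G := (hg.nonneg ∅).trans (hG ∅ (by simp))
  have h1 : 0 ≤ ∑ u ∈ S, (g (insert u (S.erase u)) - g (S.erase u)) :=
    Finset.sum_nonneg fun u _ => sub_nonneg.2 (hg.mono _ _ (Finset.subset_insert _ _))
  have h2 : ∑ v ∈ T, (g (insert v (S.erase v)) - g (S.erase v)) ≤ ∑ _v ∈ T, G := by
    refine Finset.sum_le_sum fun v hv => ?_
    have h3 := hg.marginal_anti (Finset.empty_subset (S.erase v)) (Finset.notMem_erase v S)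
    have h4 := hG {v} (hT.subset (by simpa using hv))
    have h5 := hg.nonneg ∅
    rw [insert_empty_eq] at h3
    linarith
  rw [Finset.sum_const, nsmul_eq_mul] at h2
  have h6 : (T.card : ℝ) * G ≤ Fintype.card X * G := by
    gcongr
    exact Finset.card_le_univ T
  rw [← hmax, exchangeGain]
  linarith

end MaxGain

/-! ### The randomized local search: expected progress of its steps. -/

namespace QueryAlg

variable {X : Type*} [Fintype X] [DecidableEq X]

/-- One step of the local search with random sets of `s` leaving and `t` entering candidates. -/
noncomputable def randomStep (s t : ℕ) (L : List (Finset X)) : QueryAlg X (List (Finset X)) :=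
  (sample ((L.getLastD ∅).powersetCard s) ∅).bind fun R₁ =>
    (sample ((Finset.univ : Finset X).powersetCard t) ∅).bind fun R₂ =>
      (step L R₁ R₂).bind fun r => ret r.2

/-- Make `j` random steps. -/
noncomputable def randomSteps (s t : ℕ) : ℕ → List (Finset X) → QueryAlg X (List (Finset X))
  | 0, L => ret L
  | j + 1, L => (randomStep s t L).bind (randomSteps s t j)

/-- The randomized local search: a random number of random steps. -/
noncomputable def randomSearch (X : Type*) [Fintype X] [DecidableEq X] (K : ℕ) :
    QueryAlg X (List (Finset X)) :=
  (greedyBase Finset.univ.toList ∅).bind fun B =>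
    (sample (Finset.range (B.card * K)) 0).bind fun J =>
      randomSteps (min B.card (Nat.sqrt (Fintype.card X / 2)))
        (Fintype.card X / 2 / min B.card (Nat.sqrt (Fintype.card X / 2))) J [B]

variable {g : Finset X → ℝ} {M : Matroid X} {s t : ℕ} {L : List (Finset X)}

theorem mem_outputs_randomStep (hL : s ≤ (L.getLastD ∅).card)
    {f : Finset X → ℝ} {I : Finset X → Bool} {L' : List (Finset X)}
    (hL' : L' ∈ (randomStep s t L).outputs f I) :
    ∃ R₁ ∈ (L.getLastD ∅).powersetCard s, ∃ R₂, ∃ r ∈ (step L R₁ R₂).outputs f I, L' = r.2 := by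
  obtain ⟨R₁, h1, hL'⟩ := (mem_outputs_bind _ _).1 hL'
  obtain ⟨R₂, h2, hL'⟩ := (mem_outputs_bind _ _).1 hL'
  obtain ⟨r, hr, hL'⟩ := (mem_outputs_bind _ _).1 hL'
  exact ⟨R₁, mem_of_mem_outputs_sample _ _ (Finset.powersetCard_nonempty.2 hL) h1, R₂, r, hr, hL'⟩

theorem isExchangeRun_randomStep (hg : IsMonotoneSubmodular g) (hrun : IsExchangeRun g M L)
    (hL : s ≤ (L.getLastD ∅).card) {L' : List (Finset X)}
    (hL' : L' ∈ (randomStep s t L).outputs g (indepOracle M)) :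
    IsExchangeRun g M L' ∧ (L'.getLastD ∅).card = (L.getLastD ∅).card := by
  obtain ⟨R₁, hR, R₂, r, hr, rfl⟩ := mem_outputs_randomStep hL hL'
  have h := (step_spec hg hrun (Finset.mem_powersetCard.1 hR).1 hr).1
  exact ⟨h, (card_le_of_indep hrun.isBase h.isBase.indep).antisymm
    (card_le_of_indep h.isBase hrun.isBase.indep)⟩

theorem isExchangeRun_randomSteps (hg : IsMonotoneSubmodular g) (j : ℕ)
    (hrun : IsExchangeRun g M L) (hL : s ≤ (L.getLastD ∅).card) {L' : List (Finset X)}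
    (hL' : L' ∈ (randomSteps s t j L).outputs g (indepOracle M)) : IsExchangeRun g M L' := by
  induction j generalizing L with
  | zero =>
    rw [randomSteps, outputs, Set.mem_singleton_iff] at hL'
    exact hL' ▸ hrun
  | succ j ih =>
    obtain ⟨L₁, h1, hL'⟩ := (mem_outputs_bind _ _).1 hL'
    obtain ⟨h2, h3⟩ := isExchangeRun_randomStep hg hrun hL h1
    exact ih h2 (h3 ▸ hL) hL'

theorem queries_randomStep_le (f : Finset X → ℝ) (I : Finset X → Bool)
    (hL : s ≤ (L.getLastD ∅).card) (ht : t ≤ Fintype.card X) :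
    (randomStep s t L).queries f I ≤ (s + t + 1) + t * (Nat.log 2 s + 1) := by
  rw [← Nat.zero_add (_ + _)]
  refine queries_bind_le _ _ (queries_sample _ _ _ _).le fun R₁ h1 => ?_
  rw [← Nat.zero_add (_ + _)]
  refine queries_bind_le _ _ (queries_sample _ _ _ _).le fun R₂ h2 => ?_
  refine queries_bind_le (a := _ + _ * (_ + 1)) (c := 0) _ _ ?_ fun _ _ => le_rfl
  have c1 := (Finset.mem_powersetCard.1
    (mem_of_mem_outputs_sample _ _ (Finset.powersetCard_nonempty.2 hL) h1)).2
  have c2 := (Finset.mem_powersetCard.1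
    (mem_of_mem_outputs_sample _ _ (Finset.powersetCard_nonempty.2 (by simpa using ht)) h2)).2
  have := queries_step f I L R₁ R₂
  rwa [c1, c2] at this

theorem queries_randomSteps_le (hg : IsMonotoneSubmodular g) (ht : t ≤ Fintype.card X) (j : ℕ)
    (hrun : IsExchangeRun g M L) (hL : s ≤ (L.getLastD ∅).card) :
    (randomSteps s t j L).queries g (indepOracle M) ≤
      j * ((s + t + 1) + t * (Nat.log 2 s + 1)) := by
  induction j generalizing L with
  | zero => exact Nat.zero_le _
  | succ j ih =>
    rw [add_mul j, one_mul, Nat.add_comm (_ * _)]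
    refine queries_bind_le _ _ (queries_randomStep_le _ _ hL ht) fun L' hL' => ?_
    obtain ⟨h2, h3⟩ := isExchangeRun_randomStep hg hrun hL hL'
    exact ih h2 (h3 ▸ hL)

/-- The step collects at least the best positive `pairGain` among the pairs of the exchange matching
that fall into both samples. The condition `2 s t ≤ |X|` keeps the expected number of such pairs at
most `1/2`, so collisions cost at most half of the total reward. -/
theorem le_expect_randomStep (hg : IsMonotoneSubmodular g) (hrun : IsExchangeRun g M L)
    (hL : s ≤ (L.getLastD ∅).card) (ht : t ≤ Fintype.card X) (hst : 2 * (s * t) ≤ Fintype.card X)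
    {c : ℝ} (hc : 0 ≤ c) (hcard : 0 < (L.getLastD ∅).card) (hX : 0 < Fintype.card X)
    (hcst : c * (2 * ((L.getLastD ∅).card * Fintype.card X)) ≤ s * t) :
    g (L.getLastD ∅) + c * maxExchangeGain g M (L.getLastD ∅) ≤
      (randomStep s t L).expect g (indepOracle M) fun L' => g (L'.getLastD ∅) := by
  obtain ⟨T, hT, hmax⟩ := exists_maxExchangeGain_eq g M (L.getLastD ∅)
  obtain ⟨φ, hinj, hφ⟩ := exists_exchange_injection hrun.isBase hT
  have hgain := hg.exchangeGain_le hinj fun v hv => (hφ v hv).1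
  have hTcard : (T \ L.getLastD ∅).card ≤ (L.getLastD ∅).card :=
    (Finset.card_le_card Finset.sdiff_subset).trans (card_le_of_indep hrun.isBase hT)
  set S := L.getLastD ∅ with hS
  set m : Finset X × Finset X → ℝ := fun R =>
    (step L R.1 R.2).expect g (indepOracle M) fun r => r.1 with hm
  set Ω := S.powersetCard s ×ˢ (Finset.univ : Finset X).powersetCard t with hΩ
  have hΩ1 : (S.powersetCard s).Nonempty := Finset.powersetCard_nonempty.2 hL
  have hΩ2 : ((Finset.univ : Finset X).powersetCard t).Nonempty :=
    Finset.powersetCard_nonempty.2 (by simpa using ht)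
  have hstep : ∀ R ∈ Ω, g S + m R ≤
      (step L R.1 R.2).expect g (indepOracle M) fun r => g (r.2.getLastD ∅) := by
    intro R hR
    rw [← expect_const g (indepOracle M) (step L R.1 R.2) (g S), hm, ← expect_add]
    refine expect_mono _ _ fun r hr => ?_
    exact (step_spec hg hrun (Finset.mem_powersetCard.1 (Finset.mem_product.1 hR).1).1 hr).2.2.1
  have hexp : g S + (∑ R ∈ Ω, m R) / Ω.card ≤
      (randomStep s t L).expect g (indepOracle M) fun L' => g (L'.getLastD ∅) := by
    have hΩc : (0 : ℝ) < Ω.card := by exact_mod_cast (hΩ1.product hΩ2).card_pos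
    rw [randomStep, expect_bind, expect_sample _ _ _ hΩ1]
    simp only [expect_bind]
    simp only [expect_sample _ _ _ hΩ2, expect]
    rw [← Finset.sum_div, div_div, ← Finset.sum_product', mul_comm, ← Nat.cast_mul,
      ← Finset.card_product, le_div_iff₀ hΩc, add_mul, div_mul_cancel₀ _ hΩc.ne', mul_comm,
      ← nsmul_eq_mul, ← Finset.sum_const, ← Finset.sum_add_distrib]
    exact Finset.sum_le_sum hstep
  refine le_trans ?_ hexp
  set p : ℝ := s / S.card * (t / Fintype.card X) with hp
  have hsum := le_sum_powersetCard_product hinj (fun v hv => (Finset.mem_sdiff.1 (hφ v hv).1).1)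
    hL ht (a := fun v => max 0 (pairGain g S (φ v, v))) (fun v _ => le_max_left _ _) (m := m)
    (fun R hR => by
      rw [← expect_const g (indepOracle M) (step L R.1 R.2) 0]
      refine expect_mono _ _ fun r hr => ?_
      exact (step_spec hg hrun (Finset.mem_powersetCard.1 (Finset.mem_product.1 hR).1).1 hr).2.1)
    (fun v hv R hR hv1 hv2 => by
      rw [← expect_const g (indepOracle M) (step L R.1 R.2) (max 0 _)]
      refine expect_mono _ _ fun r hr => ?_
      obtain ⟨-, h0, -, hle⟩ :=
        step_spec hg hrun (Finset.mem_powersetCard.1 (Finset.mem_product.1 hR).1).1 hr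
      exact max_le h0 (hle _ hv1 _ hv2 (Finset.mem_sdiff.1 hv).2 (hφ v hv).2)) hp
  have hΩc : (0 : ℝ) < Ω.card := by exact_mod_cast (hΩ1.product hΩ2).card_pos
  rw [← le_div_iff₀ hΩc] at hsum
  have hmaxle : maxExchangeGain g M S ≤ ∑ v ∈ T \ S, max 0 (pairGain g S (φ v, v)) := by
    rw [← hmax]
    exact hgain.trans (Finset.sum_le_sum fun v _ => le_max_right _ _)
  have hsum0 : 0 ≤ ∑ v ∈ T \ S, max 0 (pairGain g S (φ v, v)) :=
    Finset.sum_nonneg fun v _ => le_max_left _ _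
  have hS0 : (0 : ℝ) < S.card := by exact_mod_cast hcard
  have hX0 : (0 : ℝ) < Fintype.card X := by exact_mod_cast hX
  have hp0 : 0 ≤ p := by positivity
  have hp1 : (S.card : ℝ) * p ≤ 1 / 2 := by
    have : 2 * ((s : ℝ) * t) ≤ Fintype.card X := by exact_mod_cast hst
    rw [hp, div_mul_div_comm, mul_div_assoc', div_le_iff₀ (by positivity)]
    nlinarith
  have hp2 : ((T \ S).card : ℝ) * p ≤ 1 / 2 :=
    (mul_le_mul_of_nonneg_right (by exact_mod_cast hTcard) hp0).trans hp1
  have hcp : c ≤ p * (1 / 2) := by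
    rw [hp, div_mul_div_comm, div_mul_div_comm, le_div_iff₀ (by positivity)]
    linarith
  have hcp' : c ≤ p * (1 - (T \ S).card * p) :=
    hcp.trans (mul_le_mul_of_nonneg_left (by linarith) hp0)
  have := (mul_le_mul_of_nonneg_left hmaxle hc).trans
    ((mul_le_mul_of_nonneg_right hcp' hsum0).trans hsum)
  linarith

/-- Each step raises the expected value of `g` by at least `c` times the current expected violation;
these increments telescope below `G`. -/
theorem sum_expect_randomSteps_le (hg : IsMonotoneSubmodular g) (ht : t ≤ Fintype.card X)
    (hst : 2 * (s * t) ≤ Fintype.card X) (hX : 0 < Fintype.card X) {ρ : ℕ} (hρ : 0 < ρ)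
    (hs : s ≤ ρ) {c : ℝ} (hc : 0 ≤ c) (hcst : c * (2 * (ρ * Fintype.card X)) ≤ s * t) {G : ℝ}
    (hG : ∀ T : Finset X, M.Indep (T : Set X) → g T ≤ G) (k : ℕ) (hrun : IsExchangeRun g M L)
    (hL : (L.getLastD ∅).card = ρ) :
    c * ∑ j ∈ Finset.range k, (randomSteps s t j L).expect g (indepOracle M)
      (fun L' => maxExchangeGain g M (L'.getLastD ∅)) + g (L.getLastD ∅) ≤ G := by
  induction k generalizing L with
  | zero => simpa using hG _ hrun.isBase.indep
  | succ k ih =>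
    rw [Finset.sum_range_succ']
    simp only [randomSteps, expect_bind]
    rw [← expect_sum, mul_add, ← expect_const_mul]
    have h1 := le_expect_randomStep hg hrun (hL ▸ hs) ht hst hc (hL ▸ hρ) hX (by rwa [hL])
    have h2 : (randomStep s t L).expect g (indepOracle M) (fun L' =>
        (c * ∑ j ∈ Finset.range k, (randomSteps s t j L').expect g (indepOracle M)
          (fun L' => maxExchangeGain g M (L'.getLastD ∅))) + g (L'.getLastD ∅)) ≤ G := by
      rw [← expect_const g (indepOracle M) (randomStep s t L) G]
      refine expect_mono _ _ fun L' hL' => ?_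
      obtain ⟨h3, h4⟩ := isExchangeRun_randomStep hg hrun (hL ▸ hs) hL'
      exact ih h3 (h4.trans hL)
    rw [expect_add] at h2
    simp only [expect] at h2 ⊢
    linarith

end QueryAlg

/-! ### Sample sizes and query bounds. -/

section Arithmetic

/-- Rounding loses only a constant factor, because `s ≤ x / 2` makes the quotient at least `1`. -/
theorem card_le_mul_sample_sizes {x ρ : ℕ} (hx : 2 ≤ x) (hρ : 0 < ρ) :
    x ≤ 6 * (min ρ (Nat.sqrt (x / 2)) * (x / 2 / min ρ (Nat.sqrt (x / 2)))) := by
  have hm : 1 ≤ x / 2 := by omega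
  have hs : 0 < min ρ (Nat.sqrt (x / 2)) := lt_min hρ (Nat.sqrt_pos.2 hm)
  have hsm : min ρ (Nat.sqrt (x / 2)) ≤ x / 2 := (min_le_right _ _).trans (Nat.sqrt_le_self _)
  have hx2 : x ≤ 2 * (x / 2) + 1 := by omega
  generalize x / 2 = m at *
  generalize min ρ (Nat.sqrt m) = s at *
  have h1 : 1 ≤ m / s := (Nat.one_le_div_iff hs).2 hsm
  have h2 := Nat.lt_mul_div_succ m hs
  nlinarith

/-- A small `ρ` gives `ρ * (m / ρ) ≤ m`; otherwise the quotient is about `√m`. This is the source of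
the two terms in `n + r √n`. -/
theorem mul_sample_size_le (m ρ : ℕ) :
    ρ * (m / min ρ (Nat.sqrt m)) ≤ m + 3 * (ρ * Nat.sqrt m) := by
  rcases min_cases ρ (Nat.sqrt m) with ⟨h, -⟩ | ⟨h, -⟩ <;> rw [h]
  · exact (Nat.mul_div_le m ρ).trans (Nat.le_add_right _ _)
  · rcases Nat.eq_zero_or_pos (Nat.sqrt m) with h0 | h0
    · simp [h0]
    · have h1 : m / Nat.sqrt m ≤ Nat.sqrt m + 2 := by
        rw [Nat.div_le_iff_le_mul_add_pred h0]
        have := Nat.sqrt_le_add m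
        rw [mul_add]
        omega
      calc ρ * (m / Nat.sqrt m) ≤ ρ * (3 * Nat.sqrt m) :=
            Nat.mul_le_mul_left _ (h1.trans (by omega))
        _ = 3 * (ρ * Nat.sqrt m) := by ring
        _ ≤ _ := Nat.le_add_left _ _

/-- The factor `2` absorbs the change of base, as `log 2 > 1/2`. -/
theorem natLog_two_le {s x : ℕ} (h : s ≤ x) :
    (Nat.log 2 s : ℝ) ≤ 2 * Real.log ((x : ℝ) + 1) := by
  rcases Nat.eq_zero_or_pos s with rfl | hs
  · simp only [Nat.log_zero_right, Nat.cast_zero]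
    have : 0 ≤ Real.log ((x : ℝ) + 1) := Real.log_nonneg (by
      have : (0 : ℝ) ≤ x := Nat.cast_nonneg x
      linarith)
    linarith
  · have h1 : ((2 : ℝ) ^ Nat.log 2 s) ≤ x + 1 := by
      have := (Nat.pow_log_le_self 2 hs.ne').trans h
      have h2 : ((2 : ℝ) ^ Nat.log 2 s) ≤ x := by exact_mod_cast this
      linarith
    have h2 := Real.log_le_log (by positivity) h1
    rw [Real.log_pow] at h2
    have h3 := Real.log_two_gt_d9
    have h4 : (0 : ℝ) ≤ Nat.log 2 s := Nat.cast_nonneg _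
    nlinarith

theorem det_cost_le {x ρ K : ℕ} (hρ : 1 ≤ ρ) (hρx : ρ ≤ x) (hK : 1 ≤ K) :
    ((x + (ρ * K + 1) * ((ρ + x + 1) + x * (Nat.log 2 ρ + 1)) : ℕ) : ℝ) ≤
      9 * K * (x * ρ) * (1 + Real.log ((x : ℝ) + 1)) := by
  have hlog := natLog_two_le hρx
  push_cast
  have h1 : (1 : ℝ) ≤ ρ := by exact_mod_cast hρ
  have h2 : (ρ : ℝ) ≤ x := by exact_mod_cast hρx
  have h3 : (1 : ℝ) ≤ K := by exact_mod_cast hK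
  have h4 : (0 : ℝ) ≤ Real.log ((x : ℝ) + 1) := Real.log_nonneg (by linarith)
  generalize Real.log ((x : ℝ) + 1) = lg at *
  have hρK : (1 : ℝ) ≤ ρ * K := one_le_mul_of_one_le_of_one_le h1 h3
  have hx : (0 : ℝ) ≤ x := by linarith
  have e1 : (ρ : ℝ) + x + 1 + x * (Nat.log 2 ρ + 1) ≤ x * (4 + 2 * lg) := by nlinarith
  have e2 : ((ρ : ℝ) * K + 1) * (ρ + x + 1 + x * (Nat.log 2 ρ + 1)) ≤
      (2 * (ρ * K)) * (x * (4 + 2 * lg)) :=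
    mul_le_mul (by linarith) e1 (by positivity) (by positivity)
  have e3 : (x : ℝ) ≤ x * (ρ * K) := le_mul_of_one_le_right hx hρK
  have e4 : 0 ≤ (x : ℝ) * (ρ * K) * lg := by positivity
  nlinarith

theorem rand_cost_le {x ρ K : ℕ} (hρx : ρ ≤ x) (hK : 1 ≤ K) :
    ((x + ρ * K * ((min ρ (Nat.sqrt (x / 2)) + x / 2 / min ρ (Nat.sqrt (x / 2)) + 1) +
        x / 2 / min ρ (Nat.sqrt (x / 2)) * (Nat.log 2 (min ρ (Nat.sqrt (x / 2))) + 1)) : ℕ) : ℝ) ≤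
      9 * K * (x + ρ * Real.sqrt x) * (1 + Real.log ((x : ℝ) + 1)) := by
  have hlog := natLog_two_le ((min_le_left ρ (Nat.sqrt (x / 2))).trans hρx)
  have ht := mul_sample_size_le (x / 2) ρ
  have hs : min ρ (Nat.sqrt (x / 2)) ≤ Nat.sqrt (x / 2) := min_le_right _ _
  generalize min ρ (Nat.sqrt (x / 2)) = s at *
  generalize x / 2 / s = t at *
  have hsq : (Nat.sqrt (x / 2) : ℝ) ≤ Real.sqrt x :=
    Real.nat_sqrt_le_real_sqrt.trans (Real.sqrt_le_sqrt (by exact_mod_cast Nat.div_le_self x 2))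
  have hm : ((x / 2 : ℕ) : ℝ) ≤ x := by exact_mod_cast Nat.div_le_self x 2
  have hs' : (s : ℝ) ≤ Real.sqrt x := le_trans (by exact_mod_cast hs) hsq
  have ht' : (ρ : ℝ) * t ≤ x + 3 * (ρ * Real.sqrt x) := by
    have : ((ρ : ℝ) * t) ≤ (x / 2 : ℕ) + 3 * (ρ * (Nat.sqrt (x / 2) : ℝ)) := by exact_mod_cast ht
    refine this.trans ?_
    gcongr
  have hρ0 : (0 : ℝ) ≤ ρ := Nat.cast_nonneg ρ
  have hρ' : (ρ : ℝ) ≤ x := by exact_mod_cast hρx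
  have hK' : (1 : ℝ) ≤ K := by exact_mod_cast hK
  have hx : (0 : ℝ) ≤ x := Nat.cast_nonneg x
  have hlg : (0 : ℝ) ≤ Real.log ((x : ℝ) + 1) := Real.log_nonneg (by linarith)
  push_cast
  generalize Real.log ((x : ℝ) + 1) = lg at *
  have hρs : (ρ : ℝ) * s ≤ ρ * Real.sqrt x := by gcongr
  have hq : 0 ≤ (ρ : ℝ) * Real.sqrt x := by positivity
  generalize (ρ : ℝ) * Real.sqrt x = q at *
  have e1 : (ρ : ℝ) * t * (Nat.log 2 s + 2) ≤ (x + 3 * q) * (2 * lg + 2) :=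
    mul_le_mul ht' (by linarith) (by positivity) (by positivity)
  have e2 : (ρ : ℝ) * s + ρ + ρ * t * (Nat.log 2 s + 2) ≤ (x + q) * (8 + 6 * lg) := by
    have : 0 ≤ x * lg := by positivity
    nlinarith
  have e3 : (K : ℝ) * (ρ * s + ρ + ρ * t * (Nat.log 2 s + 2)) ≤ K * ((x + q) * (8 + 6 * lg)) := by
    gcongr
  have e4 : (x : ℝ) + q ≤ K * (x + q) := le_mul_of_one_le_left (by linarith) hK'
  have e5 : 0 ≤ (K : ℝ) * (x + q) * lg := by positivity
  nlinarith

end Arithmetic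

/-! ### The randomized local search: expected violation and cost. -/

namespace QueryAlg

variable {X : Type*} [Fintype X] [DecidableEq X] {g : Finset X → ℝ} {M : Matroid X} {ρ : ℕ}

theorem mem_outputs_randomSearch {K : ℕ} (hρ : ∀ B : Finset X, M.IsBase (B : Set X) → B.card = ρ)
    {L : List (Finset X)} (hL : L ∈ (randomSearch X K).outputs g (indepOracle M)) :
    ∃ B : Finset X, M.IsBase (B : Set X) ∧ ∃ J,
      L ∈ (randomSteps (min ρ (Nat.sqrt (Fintype.card X / 2)))
        (Fintype.card X / 2 / min ρ (Nat.sqrt (Fintype.card X / 2))) J [B]).outputs g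
          (indepOracle M) := by
  obtain ⟨B, hB, hL⟩ := (mem_outputs_bind _ _).1 hL
  obtain ⟨J, hJ, hL⟩ := (mem_outputs_bind _ _).1 hL
  have hBase := isBase_of_mem_outputs_greedyBase _ g M (by simp) hB
  rw [hρ B hBase] at hL
  exact ⟨B, hBase, J, hL⟩

theorem isExchangeRun_randomSearch (hg : IsMonotoneSubmodular g) {K : ℕ}
    (hρ : ∀ B : Finset X, M.IsBase (B : Set X) → B.card = ρ) {L : List (Finset X)}
    (hL : L ∈ (randomSearch X K).outputs g (indepOracle M)) : IsExchangeRun g M L := by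
  obtain ⟨B, hB, J, hL⟩ := mem_outputs_randomSearch hρ hL
  exact isExchangeRun_randomSteps hg J (.singleton hB) (by simp [hρ B hB]) hL

theorem expect_randomSearch_le (hg : IsMonotoneSubmodular g) {K : ℕ} (hK : 0 < K)
    (hρ : ∀ B : Finset X, M.IsBase (B : Set X) → B.card = ρ) (hX : 0 < ρ → 2 ≤ Fintype.card X)
    {G : ℝ} (hG : ∀ T : Finset X, M.Indep (T : Set X) → g T ≤ G) :
    (randomSearch X K).expect g (indepOracle M) (fun L => maxExchangeGain g M (L.getLastD ∅)) ≤
      12 * G / K := by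
  have hG0 : 0 ≤ G := (hg.nonneg ∅).trans (hG ∅ (by simp))
  rw [randomSearch, expect_bind,
    ← expect_const g (indepOracle M) (greedyBase Finset.univ.toList ∅) (12 * G / K)]
  refine expect_mono _ _ fun B hB => ?_
  have hBase := isBase_of_mem_outputs_greedyBase _ g M (by simp) hB
  have hBρ := hρ B hBase
  rw [hBρ, expect_bind]
  -- In rank zero the range of stopping times is empty, so the default time `0` is used, and `∅` is
  -- the only independent set.
  rcases Nat.eq_zero_or_pos ρ with h0 | hpos
  · have hB0 : B = ∅ := Finset.card_eq_zero.1 (hBρ.trans h0)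
    obtain ⟨T, hT, hmax⟩ := exists_maxExchangeGain_eq g M ∅
    have hT0 : T = ∅ := Finset.card_eq_zero.1
      (Nat.le_zero.1 ((card_le_of_indep hBase hT).trans (hBρ.trans h0).le))
    rw [hT0, exchangeGain_self] at hmax
    subst h0 hB0
    simp only [zero_mul, Finset.range_zero, sample, Finset.not_nonempty_empty, dif_neg,
      not_false_eq_true, expect, randomSteps]
    have : [(∅ : Finset X)].getLastD ∅ = ∅ := rfl
    rw [this, ← hmax]
    positivity
  · have h2X := hX hpos
    have hsX := card_le_mul_sample_sizes h2X hpos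
    have hst : min ρ (Nat.sqrt (Fintype.card X / 2)) *
        (Fintype.card X / 2 / min ρ (Nat.sqrt (Fintype.card X / 2))) ≤ Fintype.card X / 2 :=
      Nat.mul_div_le _ _
    have ht : Fintype.card X / 2 / min ρ (Nat.sqrt (Fintype.card X / 2)) ≤ Fintype.card X :=
      (Nat.div_le_self _ _).trans (Nat.div_le_self _ _)
    have hs : min ρ (Nat.sqrt (Fintype.card X / 2)) ≤ ρ := min_le_left _ _
    generalize Fintype.card X / 2 / min ρ (Nat.sqrt (Fintype.card X / 2)) = t at *
    generalize min ρ (Nat.sqrt (Fintype.card X / 2)) = s at *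
    have hρ0 : (0 : ℝ) < ρ := by exact_mod_cast hpos
    have hK0 : (0 : ℝ) < K := by exact_mod_cast hK
    -- From `|X| ≤ 6 s t`: the fraction `s t / (2 ρ |X|)` of the violation gained per step is at
    -- least `1 / (12 ρ)`.
    have key := sum_expect_randomSteps_le (L := [B]) hg ht (by omega) (by omega) hpos hs
      (c := 1 / (12 * ρ)) (by positivity) (by
        have : (Fintype.card X : ℝ) ≤ 6 * (s * t) := by exact_mod_cast hsX
        field_simp
        linarith) hG (ρ * K) (.singleton hBase) hBρ
    have hgB := hg.nonneg ([B].getLastD ∅)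
    -- The uniform stopping time turns the bound on the sum of the expected violations into a bound
    -- on their average.
    rw [expect_sample _ _ _ (Finset.nonempty_range_iff.2 (by positivity)), Finset.card_range]
    generalize ∑ j ∈ Finset.range (ρ * K), (randomSteps s t j [B]).expect g (indepOracle M)
      (fun L' => maxExchangeGain g M (L'.getLastD ∅)) = z at key ⊢
    have h1 : 1 / (12 * (ρ : ℝ)) * z ≤ G := by linarith
    rw [one_div_mul_eq_div, div_le_iff₀ (by positivity)] at h1
    push_cast
    rw [div_le_div_iff₀ (by positivity) hK0]
    nlinarith

theorem queries_randomSearch_le (hg : IsMonotoneSubmodular g) (K : ℕ)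
    (hρ : ∀ B : Finset X, M.IsBase (B : Set X) → B.card = ρ) :
    (randomSearch X K).queries g (indepOracle M) ≤ Fintype.card X +
      ρ * K * ((min ρ (Nat.sqrt (Fintype.card X / 2)) +
          Fintype.card X / 2 / min ρ (Nat.sqrt (Fintype.card X / 2)) + 1) +
        Fintype.card X / 2 / min ρ (Nat.sqrt (Fintype.card X / 2)) *
          (Nat.log 2 (min ρ (Nat.sqrt (Fintype.card X / 2))) + 1)) := by
  refine queries_bind_le _ _ (by simp [queries_greedyBase]) fun B hB => ?_
  have hBase := isBase_of_mem_outputs_greedyBase _ g M (by simp) hB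
  have hBρ := hρ B hBase
  rw [hBρ, ← Nat.zero_add (_ * (_ + _))]
  refine queries_bind_le _ _ (queries_sample _ _ _ _).le fun J hJ => ?_
  have hJ' : J ≤ ρ * K := by
    rcases (Finset.range (ρ * K)).eq_empty_or_nonempty with h | h
    · simp only [h, sample, Finset.not_nonempty_empty, dif_neg, not_false_eq_true, outputs,
        Set.mem_singleton_iff] at hJ
      omega
    · exact (Finset.mem_range.1 (mem_of_mem_outputs_sample _ _ h hJ)).le
  refine (queries_randomSteps_le hg ((Nat.div_le_self _ _).trans (Nat.div_le_self _ _)) J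
    (.singleton hBase) (by simp [hBρ])).trans ?_
  gcongr

end QueryAlg

/-! ### Sums of marginals of submodular functions. -/

section Submodular

variable {X : Type*} [DecidableEq X] {g : Finset X → ℝ} (hg : IsMonotoneSubmodular g)
include hg

theorem IsMonotoneSubmodular.le_add_sum_marginals (A O : Finset X) :
    g (O ∪ A) ≤ g A + ∑ v ∈ O, (g (insert v A) - g A) := by
  induction O using Finset.induction_on with
  | empty => simp
  | insert v O hv ih =>
    rw [Finset.sum_insert hv, Finset.insert_union]
    by_cases hmem : v ∈ O ∪ A
    · rw [Finset.insert_eq_of_mem hmem]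
      have := hg.mono A (insert v A) (Finset.subset_insert _ _)
      linarith
    · have := hg.marginal_anti (Finset.subset_union_right : A ⊆ O ∪ A) hmem
      linarith

theorem IsMonotoneSubmodular.sum_marginals_le {A P : Finset X} (hA : A ⊆ P) :
    ∑ p ∈ A, (g P - g (P.erase p)) ≤ g P - g (P \ A) := by
  induction A using Finset.induction_on with
  | empty => simp
  | insert p A hp ih =>
    obtain ⟨hpP, hAP⟩ := Finset.insert_subset_iff.1 hA
    have h1 : insert p (P \ insert p A) = P \ A := by
      ext x
      simp only [Finset.mem_insert, Finset.mem_sdiff]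
      grind
    have h2 := hg.marginal_anti (A := P \ insert p A) (B := P.erase p) (v := p)
      (fun x hx => by
        simp only [Finset.mem_sdiff, Finset.mem_insert, not_or] at hx
        exact Finset.mem_erase.2 ⟨hx.2.1, hx.1⟩) (Finset.notMem_erase p P)
    rw [h1, Finset.insert_erase hpP] at h2
    rw [Finset.sum_insert hp]
    linarith [ih hAP]

end Submodular

/-! ### Unions of layers, and submodularity of the auxiliary objective. -/

section UnionOf

variable {N : Type*} [DecidableEq N] {l : ℕ}

theorem mem_unionOf {S : Finset (N × Fin l)} {J : Finset (Fin l)} {u : N} :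
    u ∈ unionOf S J ↔ ∃ i ∈ J, (u, i) ∈ S := by
  simp only [unionOf, Finset.mem_image, Finset.mem_filter, Prod.exists, exists_and_right,
    exists_eq_right]
  exact ⟨fun ⟨i, h1, h2⟩ => ⟨i, h2, h1⟩, fun ⟨i, h1, h2⟩ => ⟨i, h2, h1⟩⟩

theorem unionOf_mono {S T : Finset (N × Fin l)} {J J' : Finset (Fin l)} (h : S ⊆ T)
    (hJ : J ⊆ J') : unionOf S J ⊆ unionOf T J' := fun u hu => by
  obtain ⟨i, hi, hS⟩ := mem_unionOf.1 hu
  exact mem_unionOf.2 ⟨i, hJ hi, h hS⟩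

theorem unionOf_union (S T : Finset (N × Fin l)) (J : Finset (Fin l)) :
    unionOf (S ∪ T) J = unionOf S J ∪ unionOf T J := by
  simp [unionOf, Finset.filter_union, Finset.image_union]

theorem unionOf_insert_of_mem (S : Finset (N × Fin l)) {J : Finset (Fin l)} {i : Fin l} (u : N)
    (hi : i ∈ J) : unionOf (insert (u, i) S) J = insert u (unionOf S J) := by
  simp [unionOf, Finset.filter_insert, hi]

theorem unionOf_sdiff_filter (S : Finset (N × Fin l)) (J : Finset (Fin l)) (i : Fin l) :
    unionOf (S \ S.filter (·.2 = i)) J = unionOf S (J.erase i) := by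
  ext u
  simp only [mem_unionOf, Finset.mem_sdiff, Finset.mem_filter, Finset.mem_erase]
  grind

theorem unionOf_erase_of_notMem (S : Finset (N × Fin l)) {J : Finset (Fin l)} {p : N × Fin l}
    (hp : p.2 ∉ J) : unionOf (S.erase p) J = unionOf S J := by
  ext u
  simp only [mem_unionOf, Finset.mem_erase]
  grind

variable {f : Finset N → ℝ} (hf : IsMonotoneSubmodular f)
include hf

theorem IsMonotoneSubmodular.comp_unionOf (J : Finset (Fin l)) :
    IsMonotoneSubmodular fun S : Finset (N × Fin l) => f (unionOf S J) where
  nonneg S := hf.nonneg _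
  mono S T h := hf.mono _ _ (unionOf_mono h subset_rfl)
  submod S T := by
    have h1 := hf.submod (unionOf S J) (unionOf T J)
    have h2 := hf.mono (unionOf (S ∩ T) J) (unionOf S J ∩ unionOf T J) (Finset.subset_inter
      (unionOf_mono Finset.inter_subset_left subset_rfl)
      (unionOf_mono Finset.inter_subset_right subset_rfl))
    rw [unionOf_union]
    linarith

theorem IsMonotoneSubmodular.auxObjective {α : ℕ → ℝ} (hα : ∀ i ≤ l, 0 ≤ α i) :
    IsMonotoneSubmodular (auxObjective (l := l) f α) where
  nonneg S := Finset.sum_nonneg fun J _ => mul_nonneg (hα _ (by simpa using J.card_le_univ))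
    (hf.nonneg _)
  mono S T h := Finset.sum_le_sum fun J _ => mul_le_mul_of_nonneg_left
    ((hf.comp_unionOf J).mono S T h) (hα _ (by simpa using J.card_le_univ))
  submod S T := by
    simp only [_root_.auxObjective]
    rw [← Finset.sum_add_distrib, ← Finset.sum_add_distrib]
    refine Finset.sum_le_sum fun J _ => ?_
    rw [← mul_add, ← mul_add]
    exact mul_le_mul_of_nonneg_left ((hf.comp_unionOf J).submod S T)
      (hα _ (by simpa using J.card_le_univ))

end UnionOf

/-! ### The weights and the approximation ratio of local optima. -/

section Approximation

variable {l : ℕ}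

theorem sum_sum_mem_comm (φ : Finset (Fin l) → Fin l → ℝ) :
    ∑ J : Finset (Fin l), ∑ i ∈ J, φ J i =
      ∑ i, ∑ J ∈ Finset.univ.filter (fun J : Finset (Fin l) => i ∈ J), φ J i := by
  rw [Finset.sum_comm' (s' := fun i => Finset.univ.filter (fun J : Finset (Fin l) => i ∈ J))
    (t' := Finset.univ)]
  simp

/-- Reindexing by `J.erase i`: a set of size `j` arises from `l - j` larger sets, each of size `j +
1`. -/
theorem sum_sum_erase (α : ℕ → ℝ) (F : Finset (Fin l) → ℝ) :
    ∑ J : Finset (Fin l), α J.card * ∑ i ∈ J, F (J.erase i) =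
      ∑ J : Finset (Fin l), (l - J.card) * α (J.card + 1) * F J := by
  have h1 : ∀ i : Fin l, ∑ J ∈ Finset.univ.filter (fun J : Finset (Fin l) => i ∈ J),
      α J.card * F (J.erase i) =
      ∑ J ∈ Finset.univ.filter (fun J : Finset (Fin l) => i ∉ J), α (J.card + 1) * F J := by
    intro i
    refine Finset.sum_nbij' (fun J => J.erase i) (fun J => insert i J) ?_ ?_ ?_ ?_ ?_
    · simp
    · simp
    · intro J hJ
      exact Finset.insert_erase (by simpa using hJ)
    · intro J hJ
      exact Finset.erase_insert (by simpa using hJ)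
    · intro J hJ
      rw [Finset.card_erase_add_one (by simpa using hJ)]
  simp only [Finset.mul_sum]
  rw [sum_sum_mem_comm fun J i => α J.card * F (J.erase i)]
  simp only [h1]
  rw [Finset.sum_comm' (s' := fun J => Jᶜ) (t' := Finset.univ) (by simp)]
  refine Finset.sum_congr rfl fun J _ => ?_
  rw [Finset.sum_const, Finset.card_compl, Fintype.card_fin, nsmul_eq_mul,
    Nat.cast_sub (by simpa using J.card_le_univ), mul_assoc]

/-- The weights of the auxiliary objective. -/
noncomputable def auxWeight (l i : ℕ) : ℝ :=
  if i = 0 then 0 else (1 + 1 / (l : ℝ)) ^ (i - 1) / ((l - 1).choose (i - 1) : ℝ)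

theorem auxWeight_zero (l : ℕ) : auxWeight l 0 = 0 := if_pos rfl

theorem auxWeight_pos {l i : ℕ} (h1 : 1 ≤ i) (h2 : i ≤ l) : 0 < auxWeight l i := by
  rw [auxWeight, if_neg (by omega)]
  have : 0 < (l - 1).choose (i - 1) := Nat.choose_pos (by omega)
  positivity

theorem auxWeight_nonneg {l i : ℕ} (h : i ≤ l) : 0 ≤ auxWeight l i := by
  rcases Nat.eq_zero_or_pos i with rfl | h0
  · exact (auxWeight_zero l).ge
  · exact (auxWeight_pos h0 h).le

theorem auxWeight_one (l : ℕ) : auxWeight l 1 = 1 := by simp [auxWeight]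

theorem auxWeight_self {l : ℕ} (hl : 1 ≤ l) : auxWeight l l = (1 + 1 / (l : ℝ)) ^ (l - 1) := by
  rw [auxWeight, if_neg (by omega)]
  simp

/-- This recursion is the reason for the form of the weights: the left-hand side is the coefficient
of `f (unionOf S J)` with `J.card = j` in the summed local-optimality inequality. -/
theorem auxWeight_succ {l j : ℕ} (h1 : 1 ≤ j) (h2 : j < l) :
    (l + 1) * j * auxWeight l j - l * ((l - j) * auxWeight l (j + 1)) = 0 := by
  obtain ⟨i, rfl⟩ : ∃ i, j = i + 1 := ⟨j - 1, by omega⟩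
  obtain ⟨m, rfl⟩ : ∃ m, l = m + 1 := ⟨l - 1, by omega⟩
  have hc := Nat.choose_succ_right_eq m i
  have p1 : (0 : ℝ) < m.choose i := by exact_mod_cast Nat.choose_pos (by omega : i ≤ m)
  have p2 : (0 : ℝ) < m.choose (i + 1) := by
    exact_mod_cast Nat.choose_pos (by omega : i + 1 ≤ m)
  have hc' : (m.choose (i + 1) : ℝ) * (i + 1) = m.choose i * (m - i) := by
    rw [← Nat.cast_sub (by omega : i ≤ m)]
    exact_mod_cast hc
  simp only [auxWeight, Nat.add_eq_zero_iff, one_ne_zero, and_false, if_false,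
    Nat.add_sub_cancel, pow_succ]
  push_cast
  have hm : (m : ℝ) + 1 ≠ 0 := by positivity
  generalize (1 + 1 / ((m : ℝ) + 1)) ^ i = E
  field_simp
  linear_combination E * ((m : ℝ) + 2) * hc'

/-- The linear combination of the values of a set function that the local search controls. -/
theorem sum_auxWeight_mul_le (hl : 1 ≤ l) {F : Finset (Fin l) → ℝ} (hF : 0 ≤ F ∅) :
    ∑ J : Finset (Fin l), ((l + 1) * J.card * auxWeight l J.card -
        l * ((l - J.card) * auxWeight l (J.card + 1))) * F J ≤
      (l + 1) * l * auxWeight l l * F Finset.univ := by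
  rw [← Finset.add_sum_erase _ _ (Finset.mem_univ Finset.univ)]
  -- Only `J = ∅` escapes the recursion; its coefficient is `-l ^ 2`, and it is dropped because `F ∅
  -- ≥ 0`.
  have h1 : ∑ J ∈ (Finset.univ : Finset (Finset (Fin l))).erase Finset.univ,
      ((l + 1) * J.card * auxWeight l J.card -
        l * ((l - J.card) * auxWeight l (J.card + 1))) * F J ≤ 0 := by
    refine Finset.sum_nonpos fun J hJ => ?_
    rcases J.eq_empty_or_nonempty with rfl | hne
    · have : 0 ≤ (l : ℝ) * (l * F ∅) := by positivity
      simp only [Finset.card_empty, auxWeight_zero, zero_add, auxWeight_one]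
      push_cast
      linarith
    · have hlt : J.card < l := by
        have := Finset.card_lt_card (Finset.ssubset_univ_iff.2 (Finset.ne_of_mem_erase hJ))
        simpa using this
      rw [auxWeight_succ hne.card_pos hlt, zero_mul]
  have h2 : ((Finset.univ : Finset (Fin l)).card : ℝ) = l := by simp
  simp only [Finset.card_univ, Fintype.card_fin, sub_self, zero_mul, mul_zero, sub_zero] at h1 ⊢
  linarith

/-- The same cancellation for the constant function `1`, where the term of `∅` is kept. It gives the
coefficient of `f O`. -/
theorem sum_card_mul_auxWeight (hl : 1 ≤ l) :
    ∑ J : Finset (Fin l), (J.card : ℝ) * auxWeight l J.card =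
      (l + 1) * l * auxWeight l l - l ^ 2 := by
  have h1 := sum_sum_erase (l := l) (auxWeight l) fun _ => 1
  simp only [Finset.sum_const, nsmul_eq_mul, mul_one] at h1
  have h2 : ∑ J : Finset (Fin l), ((l + 1) * J.card * auxWeight l J.card -
      l * ((l - J.card) * auxWeight l (J.card + 1))) =
      (l + 1) * l * auxWeight l l - l ^ 2 := by
    have hne : (∅ : Finset (Fin l)) ∈ Finset.univ.erase Finset.univ := by
      have : Nonempty (Fin l) := ⟨⟨0, hl⟩⟩
      exact Finset.mem_erase.2 ⟨Finset.univ_nonempty.ne_empty.symm, Finset.mem_univ _⟩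
    rw [← Finset.add_sum_erase _ _ (Finset.mem_univ Finset.univ), ← Finset.add_sum_erase _ _ hne,
      Finset.sum_eq_zero]
    · simp only [Finset.card_univ, Fintype.card_fin, Finset.card_empty, auxWeight_zero, zero_add,
        auxWeight_one]
      push_cast
      ring
    · intro J hJ
      have h3 := Finset.mem_erase.1 hJ
      have hlt : J.card < l := by
        have := Finset.card_lt_card (Finset.ssubset_univ_iff.2 (Finset.ne_of_mem_erase h3.2))
        simpa using this
      exact auxWeight_succ (Finset.nonempty_iff_ne_empty.2 h3.1).card_pos hlt
  have h3 : ∑ J : Finset (Fin l), (l + 1) * (J.card : ℝ) * auxWeight l J.card =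
      (l + 1) * ∑ J : Finset (Fin l), (J.card : ℝ) * auxWeight l J.card := by
    rw [Finset.mul_sum]
    exact Finset.sum_congr rfl fun J _ => by ring
  rw [Finset.sum_sub_distrib, ← Finset.mul_sum, ← h1, h3] at h2
  simp only [mul_comm (auxWeight l _)] at h2
  linarith

variable {N : Type*} [DecidableEq N] {f : Finset N → ℝ} {M : Matroid N}
  {S : Finset (N × Fin l)} {O : Finset N}

/-- For each of the `J.card` layers `i ∈ J`, inserting all of `O` into layer `i` one element at a
time promises at least `f O - f (unionOf S J)`. Sets `J` without `i` contribute nonnegatively. -/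
theorem le_sum_sum_marginals (hf : IsMonotoneSubmodular f) {α : ℕ → ℝ} (hα : ∀ i ≤ l, 0 ≤ α i)
    (S : Finset (N × Fin l)) (O : Finset N) :
    ∑ J : Finset (Fin l), J.card * α J.card * (f O - f (unionOf S J)) ≤
      ∑ i : Fin l, ∑ v ∈ O, (auxObjective f α (insert (v, i) (S.erase (v, i))) -
        auxObjective f α (S.erase (v, i))) := by
  have hpt : ∀ (i : Fin l) (v : N),
      ∑ J ∈ Finset.univ.filter (fun J : Finset (Fin l) => i ∈ J),
        α J.card * (f (insert v (unionOf S J)) - f (unionOf S J)) ≤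
      auxObjective f α (insert (v, i) (S.erase (v, i))) - auxObjective f α (S.erase (v, i)) := by
    intro i v
    rw [auxObjective, auxObjective, ← Finset.sum_sub_distrib, Finset.sum_filter]
    refine Finset.sum_le_sum fun J _ => ?_
    have hαJ : 0 ≤ α J.card := hα _ (by simpa using J.card_le_univ)
    rw [← mul_sub]
    have hmono := (hf.comp_unionOf J).mono (S.erase (v, i)) (insert (v, i) (S.erase (v, i)))
      (Finset.subset_insert _ _)
    split_ifs with hi
    · refine mul_le_mul_of_nonneg_left ?_ hαJ
      -- If the pair is already in `S`, then `v` is in the union and the lower bound is `0`.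
      by_cases hS : (v, i) ∈ S
      · rw [Finset.insert_eq_of_mem (mem_unionOf.2 ⟨i, hi, hS⟩), sub_self]
        exact sub_nonneg.2 hmono
      · rw [Finset.erase_eq_of_notMem hS, unionOf_insert_of_mem S v hi]
    · exact mul_nonneg hαJ (sub_nonneg.2 hmono)
  refine le_trans ?_ (Finset.sum_le_sum fun i _ => Finset.sum_le_sum fun v _ => hpt i v)
  have hcomm : ∑ i : Fin l, ∑ v ∈ O, ∑ J ∈ Finset.univ.filter (fun J : Finset (Fin l) => i ∈ J),
      α J.card * (f (insert v (unionOf S J)) - f (unionOf S J)) =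
      ∑ J : Finset (Fin l), J.card * α J.card *
        ∑ v ∈ O, (f (insert v (unionOf S J)) - f (unionOf S J)) := by
    simp only [Finset.sum_comm (s := O), ← Finset.mul_sum]
    rw [← sum_sum_mem_comm fun J _ =>
      α J.card * ∑ v ∈ O, (f (insert v (unionOf S J)) - f (unionOf S J))]
    refine Finset.sum_congr rfl fun J _ => ?_
    rw [Finset.sum_const, nsmul_eq_mul, mul_assoc]
  rw [hcomm]
  refine Finset.sum_le_sum fun J _ => mul_le_mul_of_nonneg_left ?_
    (mul_nonneg (Nat.cast_nonneg _) (hα _ (by simpa using J.card_le_univ)))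
  have h1 := hf.le_add_sum_marginals (unionOf S J) O
  have h2 := hf.mono O (O ∪ unionOf S J) Finset.subset_union_left
  linarith

/-- For fixed `J`, the single-removal losses inside a layer `i ∈ J` add up to at most the loss of
removing the whole layer; layers outside `J` lose nothing. -/
theorem sum_marginals_auxObjective_le (hf : IsMonotoneSubmodular f) {α : ℕ → ℝ}
    (hα : ∀ i ≤ l, 0 ≤ α i) (S : Finset (N × Fin l)) :
    ∑ p ∈ S, (auxObjective f α (insert p (S.erase p)) - auxObjective f α (S.erase p)) ≤
      ∑ J : Finset (Fin l), α J.card * ∑ i ∈ J, (f (unionOf S J) - f (unionOf S (J.erase i))) := by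
  have h1 : ∑ p ∈ S, (auxObjective f α (insert p (S.erase p)) - auxObjective f α (S.erase p)) =
      ∑ J : Finset (Fin l), α J.card *
        ∑ p ∈ S, (f (unionOf S J) - f (unionOf (S.erase p) J)) := by
    simp only [Finset.mul_sum]
    rw [Finset.sum_comm]
    refine Finset.sum_congr rfl fun p hp => ?_
    rw [Finset.insert_erase hp, auxObjective, auxObjective, ← Finset.sum_sub_distrib]
    exact Finset.sum_congr rfl fun J _ => (mul_sub _ _ _).symm
  rw [h1]
  refine Finset.sum_le_sum fun J _ => mul_le_mul_of_nonneg_left ?_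
    (hα _ (by simpa using J.card_le_univ))
  have h2 : ∑ p ∈ S, (f (unionOf S J) - f (unionOf (S.erase p) J)) =
      ∑ i ∈ J, ∑ p ∈ S.filter (·.2 = i), (f (unionOf S J) - f (unionOf (S.erase p) J)) := by
    rw [Finset.sum_fiberwise_eq_sum_filter, Finset.sum_filter]
    refine Finset.sum_congr rfl fun p _ => ?_
    split_ifs with hp
    · rfl
    · rw [unionOf_erase_of_notMem S hp, sub_self]
  rw [h2]
  refine Finset.sum_le_sum fun i _ => ?_
  have := (hf.comp_unionOf J).sum_marginals_le (Finset.filter_subset (·.2 = i) S)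
  rwa [unionOf_sdiff_filter] at this

theorem liftMatroid_indep_image (hO : M.Indep (O : Set N)) (i : Fin l) :
    (liftMatroid M l).Indep (O.image (·, i) : Finset (N × Fin l)) := by
  rw [liftMatroid, Matroid.comap_indep_iff]
  refine ⟨?_, ?_⟩
  · convert hO
    simp [Set.image_image]
  · intro a ha b hb hab
    simp only [Finset.coe_image, Set.mem_image] at ha hb
    obtain ⟨x, -, rfl⟩ := ha
    obtain ⟨y, -, rfl⟩ := hb
    simpa using hab

theorem indep_unionOf (hS : (liftMatroid M l).Indep (S : Set (N × Fin l))) (J : Finset (Fin l)) :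
    M.Indep (unionOf S J : Set N) := by
  rw [liftMatroid, Matroid.comap_indep_iff] at hS
  refine hS.1.subset fun u hu => ?_
  obtain ⟨i, -, h⟩ := mem_unionOf.1 hu
  exact ⟨(u, i), h, rfl⟩

/-- With `E = (1 + 1/l)^l`, summing the local-optimality inequalities against `O × {i}` over all `i`
leaves `l² (E - 1) f(O) ≤ l² E f(π S) + l δ g(P)`; division by `l² E` gives the claim. -/
theorem le_of_isApproxLocalOpt (hl : 1 ≤ l) (hf : IsMonotoneSubmodular f) {δ : ℝ} (hδ : 0 ≤ δ)
    (hS : IsApproxLocalOpt (auxObjective f (auxWeight l)) (liftMatroid M l) δ S)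
    (hO : M.Indep (O : Set N)) {P : Finset (N × Fin l)}
    (hP : (liftMatroid M l).Indep (P : Set (N × Fin l)))
    (hmax : ∀ T : Finset (N × Fin l), (liftMatroid M l).Indep (T : Set (N × Fin l)) →
      auxObjective f (auxWeight l) T ≤ auxObjective f (auxWeight l) P) :
    (1 - ((1 + 1 / (l : ℝ)) ^ l)⁻¹) * f O - δ * auxObjective f (auxWeight l) P ≤
      f (unionOf S Finset.univ) := by
  have hα : ∀ i ≤ l, 0 ≤ auxWeight l i := fun i => auxWeight_nonneg
  set G := auxObjective f (auxWeight l) P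
  have hG : 0 ≤ G := (hf.auxObjective hα).nonneg P
  have h1 := le_sum_sum_marginals hf hα S O
  have h2 := sum_marginals_auxObjective_le hf hα S
  have h3 : ∑ i : Fin l, ∑ v ∈ O, (auxObjective f (auxWeight l) (insert (v, i) (S.erase (v, i))) -
      auxObjective f (auxWeight l) (S.erase (v, i))) ≤ l * (δ * G + ∑ p ∈ S,
        (auxObjective f (auxWeight l) (insert p (S.erase p)) -
          auxObjective f (auxWeight l) (S.erase p))) := by
    refine (Finset.sum_le_card_nsmul _ _ _ fun i _ => ?_).trans (le_of_eq (by
      rw [Finset.card_univ, Fintype.card_fin, nsmul_eq_mul]))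
    have h := hS.2 P hP hmax _ (liftMatroid_indep_image hO i)
    rw [Finset.sum_image (fun a _ b _ hab => by simpa using hab)] at h
    linarith
  have h4 : ∑ J : Finset (Fin l), auxWeight l J.card *
      ∑ i ∈ J, (f (unionOf S J) - f (unionOf S (J.erase i))) =
      ∑ J : Finset (Fin l), J.card * auxWeight l J.card * f (unionOf S J) -
        ∑ J : Finset (Fin l), (l - J.card) * auxWeight l (J.card + 1) * f (unionOf S J) := by
    rw [← sum_sum_erase (auxWeight l) fun J => f (unionOf S J), ← Finset.sum_sub_distrib]
    refine Finset.sum_congr rfl fun J _ => ?_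
    rw [Finset.sum_sub_distrib, Finset.sum_const, nsmul_eq_mul]
    ring
  have h5 := sum_auxWeight_mul_le hl (F := fun J => f (unionOf S J)) (hf.nonneg _)
  have h6 : ∑ J : Finset (Fin l), ((l + 1) * J.card * auxWeight l J.card -
      l * ((l - J.card) * auxWeight l (J.card + 1))) * f (unionOf S J) =
      (l + 1) * ∑ J : Finset (Fin l), J.card * auxWeight l J.card * f (unionOf S J) -
      l * ∑ J : Finset (Fin l), (l - J.card) * auxWeight l (J.card + 1) * f (unionOf S J) := by
    rw [Finset.mul_sum, Finset.mul_sum, ← Finset.sum_sub_distrib]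
    exact Finset.sum_congr rfl fun J _ => by ring
  have h7 : ∑ J : Finset (Fin l), J.card * auxWeight l J.card * (f O - f (unionOf S J)) =
      ((l + 1) * l * auxWeight l l - l ^ 2) * f O -
        ∑ J : Finset (Fin l), J.card * auxWeight l J.card * f (unionOf S J) := by
    rw [← sum_card_mul_auxWeight hl, Finset.sum_mul, ← Finset.sum_sub_distrib]
    exact Finset.sum_congr rfl fun J _ => by ring
  rw [h4] at h2
  rw [h6] at h5
  rw [h7] at h1
  have hl0 : (0 : ℝ) < l := by exact_mod_cast hl
  have h8 := mul_le_mul_of_nonneg_left h2 hl0.le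
  have hD : ((l : ℝ) + 1) * l * auxWeight l l = l ^ 2 * (1 + 1 / (l : ℝ)) ^ l := by
    obtain ⟨m, rfl⟩ : ∃ m, l = m + 1 := ⟨l - 1, by omega⟩
    rw [auxWeight_self hl, Nat.add_sub_cancel, pow_succ (1 + 1 / ((m + 1 : ℕ) : ℝ)) m]
    field_simp
  rw [hD] at h1 h5
  have hfin : (l ^ 2 * (1 + 1 / (l : ℝ)) ^ l - l ^ 2) * f O ≤
      l ^ 2 * (1 + 1 / (l : ℝ)) ^ l * f (unionOf S Finset.univ) + l * (δ * G) := by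
    linarith
  have hE : (1 : ℝ) ≤ (1 + 1 / (l : ℝ)) ^ l := one_le_pow₀ (by
    have : 0 < 1 / (l : ℝ) := by positivity
    linarith)
  have hl1 : (1 : ℝ) ≤ l := by exact_mod_cast hl
  generalize (1 + 1 / (l : ℝ)) ^ l = E at *
  have hE0 : 0 < E := by linarith
  have hδG : 0 ≤ δ * G := by positivity
  have h9 : (l : ℝ) * (δ * G) ≤ l ^ 2 * E * (δ * G) := by
    gcongr
    nlinarith
  have h10 : l ^ 2 * E * ((1 - E⁻¹) * f O - δ * G) ≤ l ^ 2 * E * f (unionOf S Finset.univ) := by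
    have : l ^ 2 * E * ((1 - E⁻¹) * f O - δ * G) =
        (l ^ 2 * E - l ^ 2) * f O - l ^ 2 * E * (δ * G) := by
      field_simp
    linarith
  exact le_of_mul_le_mul_left h10 (by positivity)

/-- The sum of the weights of the auxiliary objective. -/
noncomputable def auxWeightSum (l : ℕ) : ℝ := ∑ J : Finset (Fin l), auxWeight l J.card

theorem auxWeightSum_nonneg (l : ℕ) : 0 ≤ auxWeightSum l :=
  Finset.sum_nonneg fun J _ => auxWeight_nonneg (by simpa using J.card_le_univ)

/-- Converts the error term, measured by the maximum of the auxiliary objective, into a multiple of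
the maximum of `f`. -/
theorem auxObjective_le {c : ℝ}
    (hc : ∀ O : Finset N, M.Indep (O : Set N) → f O ≤ c)
    (hS : (liftMatroid M l).Indep (S : Set (N × Fin l))) :
    auxObjective f (auxWeight l) S ≤ auxWeightSum l * c := by
  rw [auxObjective, auxWeightSum, Finset.sum_mul]
  exact Finset.sum_le_sum fun J _ => mul_le_mul_of_nonneg_left (hc _ (indep_unionOf hS J))
    (auxWeight_nonneg (by simpa using J.card_le_univ))

omit [DecidableEq N] in
theorem exists_max_indep [Fintype N] (f : Finset N → ℝ) (M : Matroid N) :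
    ∃ P : Finset N, M.Indep (P : Set N) ∧ ∀ T : Finset N, M.Indep (T : Set N) → f T ≤ f P := by
  classical
  obtain ⟨P, hP, hmax⟩ := Finset.exists_max_image
    ((Finset.univ : Finset (Finset N)).filter fun T : Finset N => M.Indep (T : Set N)) f
    ⟨∅, by simp⟩
  exact ⟨P, (Finset.mem_filter.1 hP).2, fun T hT => hmax T (by simpa using hT)⟩

/-- Approximate local optima are approximately as good as the best independent set. -/
theorem approx_of_isApproxLocalOpt [Fintype N] (hl : 1 ≤ l) (hf : IsMonotoneSubmodular f) {δ : ℝ}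
    (hδ : 0 ≤ δ) (hS : IsApproxLocalOpt (auxObjective f (auxWeight l)) (liftMatroid M l) δ S)
    (hO : M.Indep (O : Set N)) :
    (1 - ((1 + 1 / (l : ℝ)) ^ l)⁻¹ - δ * auxWeightSum l) * f O ≤ f (unionOf S Finset.univ) := by
  obtain ⟨P, hP, hPmax⟩ := exists_max_indep (auxObjective f (auxWeight l)) (liftMatroid M l)
  obtain ⟨Q, hQ, hQmax⟩ := exists_max_indep f M
  have h1 := le_of_isApproxLocalOpt hl hf hδ hS hQ hP hPmax
  have h2 := mul_le_mul_of_nonneg_left (auxObjective_le hQmax hP) hδ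
  have h3 := hf.nonneg O
  have h4 := hQmax O hO
  -- The bound is known for a maximizer `Q` of `f`; passing to `O` needs a nonnegative factor, and a
  -- negative factor makes the claim trivial.
  rcases le_total 0 (1 - ((1 + 1 / (l : ℝ)) ^ l)⁻¹ - δ * auxWeightSum l) with h | h
  · have := mul_le_mul_of_nonneg_left h4 h
    linarith
  · exact (mul_nonpos_of_nonpos_of_nonneg h h3).trans (hf.nonneg _)

end Approximation

/-! ### From small violation to approximate local optima. -/

section ApproxLocalOpt

variable {X : Type*} [DecidableEq X] {g : Finset X → ℝ} {M : Matroid X} {S P : Finset X}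
  {δ ε : ℝ}

theorem isApproxLocalOpt_of_exchangeGain_le (hδ : 0 ≤ δ) (hS : M.Indep (S : Set X))
    (hP : M.Indep (P : Set X))
    (h : ∀ T : Finset X, M.Indep (T : Set X) → exchangeGain g S T ≤ δ * g P) :
    IsApproxLocalOpt g M δ S :=
  ⟨hS, fun _O _hO hOmax T hT => (h T hT).trans (mul_le_mul_of_nonneg_left (hOmax P hP) hδ)⟩

theorem IsApproxLocalOpt.mono (hg : IsMonotoneSubmodular g) (h : IsApproxLocalOpt g M δ S)
    (hδε : δ ≤ ε) : IsApproxLocalOpt g M ε S :=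
  ⟨h.1, fun O hO hmax T hT => (h.2 O hO hmax T hT).trans
    (mul_le_mul_of_nonneg_right hδε (hg.nonneg O))⟩

end ApproxLocalOpt

namespace QueryAlg

variable {X : Type*} [Fintype X] [DecidableEq X] {g : Finset X → ℝ} {M : Matroid X} {δ η : ℝ}
  {K : ℕ}

theorem isApproxLocalOpt_detSearch (hg : IsMonotoneSubmodular g) (hK : 0 < K) (hKδ : 1 / δ ≤ K)
    (hδ : 0 < δ) {L : List (Finset X)}
    (hL : L ∈ (detSearch X K).outputs g (indepOracle M)) :
    IsApproxLocalOpt g M δ (L.getLastD ∅) := by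
  obtain ⟨P, hP, hmax⟩ := exists_max_indep g M
  obtain ⟨h1, h2⟩ := detSearch_spec hg K hmax hL
  refine isApproxLocalOpt_of_exchangeGain_le hδ.le h1.isBase.indep hP fun T hT => ?_
  have hK0 : (0 : ℝ) < K := by exact_mod_cast hK
  rw [div_le_iff₀ hδ] at hKδ
  refine le_of_mul_le_mul_left ((h2 T hT).trans ?_) hK0
  have := mul_le_mul_of_nonneg_right hKδ (hg.nonneg P)
  linarith

-- Markov's inequality, as the pointwise bound of the indicator of success from below by `1 -
-- violation / (δ g P)`.
open Classical in
theorem le_prob_isApproxLocalOpt_randomSearch (hg : IsMonotoneSubmodular g) {ρ : ℕ}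
    (hρ : ∀ B : Finset X, M.IsBase (B : Set X) → B.card = ρ) (hX : 0 < ρ → 2 ≤ Fintype.card X)
    (hK : 0 < K) (hδ : 0 < δ) (hη : 0 < η) (hKδ : 12 / (δ * η) ≤ K) :
    1 - η ≤ (randomSearch X K).prob g (indepOracle M) fun L =>
      IsApproxLocalOpt g M δ (L.getLastD ∅) := by
  obtain ⟨P, hP, hmax⟩ := exists_max_indep g M
  have hopt : ∀ L ∈ (randomSearch X K).outputs g (indepOracle M),
      maxExchangeGain g M (L.getLastD ∅) ≤ δ * g P →
        IsApproxLocalOpt g M δ (L.getLastD ∅) := fun L hL hle =>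
    isApproxLocalOpt_of_exchangeGain_le hδ.le (isExchangeRun_randomSearch hg hρ hL).isBase.indep hP
      fun T hT => (exchangeGain_le_max hT).trans hle
  have hK0 : (0 : ℝ) < K := by exact_mod_cast hK
  unfold prob
  -- If the maximum of `g` is zero, every violation vanishes and success is certain.
  rcases (hg.nonneg P).eq_or_lt with h0 | hpos
  · refine (sub_le_self _ hη.le).trans ?_
    refine (expect_const g (indepOracle M) (randomSearch X K) 1).symm.le.trans
      (expect_mono _ _ fun L hL => ?_)
    rw [if_pos]
    refine hopt L hL ((maxExchangeGain_le_card_mul hg hmax _).trans ?_)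
    rw [← h0, mul_zero, mul_zero]
  · have hexp := expect_randomSearch_le hg hK hρ hX hmax
    have hδP : 0 < δ * g P := mul_pos hδ hpos
    have h1 : (randomSearch X K).expect g (indepOracle M) (fun L =>
        1 + -(1 / (δ * g P)) * maxExchangeGain g M (L.getLastD ∅)) ≤
        (randomSearch X K).expect g (indepOracle M) (fun L =>
          if IsApproxLocalOpt g M δ (L.getLastD ∅) then 1 else 0) := by
      refine expect_mono _ _ fun L hL => ?_
      have hnn : 0 ≤ maxExchangeGain g M (L.getLastD ∅) :=
        maxExchangeGain_nonneg (isExchangeRun_randomSearch hg hρ hL).isBase.indep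
      split_ifs with hcase
      · have : 0 ≤ 1 / (δ * g P) * maxExchangeGain g M (L.getLastD ∅) := by positivity
        linarith
      · have hlt := not_le.1 (mt (hopt L hL) hcase)
        have : 1 ≤ 1 / (δ * g P) * maxExchangeGain g M (L.getLastD ∅) := by
          rw [one_div_mul_eq_div, one_le_div hδP]
          exact hlt.le
        linarith
    rw [expect_add, expect_const, expect_const_mul] at h1
    refine le_trans ?_ h1
    have h2 : 1 / (δ * g P) * (randomSearch X K).expect g (indepOracle M)
        (fun L => maxExchangeGain g M (L.getLastD ∅)) ≤ η := by
      refine (mul_le_mul_of_nonneg_left hexp (by positivity)).trans ?_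
      rw [div_le_iff₀ (by positivity)] at hKδ
      rw [div_mul_div_comm, one_mul, div_le_iff₀ (by positivity)]
      nlinarith
    linarith

end QueryAlg

/-! ### Rank of the lifted matroid. -/

section Rank

variable {N : Type*} [Fintype N] {M : Matroid N} {l : ℕ}

theorem card_le_toNat_eRank {I : Finset N} (hI : M.Indep (I : Set N)) :
    I.card ≤ M.eRank.toNat := by
  have h := ENat.toNat_le_toNat hI.encard_le_eRank (ne_top_of_le_ne_top
    (Set.encard_ne_top_iff.2 (Set.toFinite M.E)) M.eRank_le_encard_ground)
  simpa using h

theorem toNat_eRank_le_card (M : Matroid N) : M.eRank.toNat ≤ Fintype.card N := by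
  obtain ⟨B, hB⟩ := M.exists_isBase
  rw [← hB.encard_eq_eRank, ← Set.ncard_def, ← Nat.card_eq_fintype_card, ← Set.ncard_univ]
  exact Set.ncard_le_ncard (Set.subset_univ B)

theorem card_le_toNat_eRank_of_lift [DecidableEq N] {B : Finset (N × Fin l)}
    (hB : (liftMatroid M l).Indep (B : Set (N × Fin l))) : B.card ≤ M.eRank.toNat := by
  rw [liftMatroid, Matroid.comap_indep_iff] at hB
  rw [← Finset.card_image_of_injOn hB.2]
  exact card_le_toNat_eRank (by simpa using hB.1)

end Rank

/-! ### Choice of the constants and assembly of the theorem. -/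

theorem exists_inv_pow_le {η : ℝ} (hη : 0 < η) :
    ∃ l : ℕ, 2 ≤ l ∧ ((1 + 1 / (l : ℝ)) ^ l)⁻¹ ≤ 1 / Real.exp 1 + η := by
  have h1 := (Real.tendsto_one_add_div_pow_exp 1).inv₀ (Real.exp_pos 1).ne'
  have h2 := h1.eventually_le_const (u := 1 / Real.exp 1 + η) (by
    rw [one_div]
    linarith)
  obtain ⟨l, h3, h4⟩ := ((Filter.eventually_ge_atTop 2).and h2).exists
  exact ⟨l, h3, h4⟩

theorem one_add_log_mul_le {l n : ℕ} (hl : 1 ≤ l) :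
    1 + Real.log (((n * l : ℕ) : ℝ) + 1) ≤ l * (1 + Real.log ((n : ℝ) + 1)) := by
  have hl' : (1 : ℝ) ≤ l := by exact_mod_cast hl
  have hn : (0 : ℝ) ≤ n := Nat.cast_nonneg n
  have h1 : Real.log (((n * l : ℕ) : ℝ) + 1) ≤ Real.log (l * ((n : ℝ) + 1)) := by
    refine Real.log_le_log (by positivity) ?_
    push_cast
    nlinarith
  rw [Real.log_mul (by positivity) (by positivity)] at h1
  have h2 := Real.log_le_sub_one_of_pos (by linarith : (0 : ℝ) < l)
  have h3 : 0 ≤ Real.log ((n : ℝ) + 1) := Real.log_nonneg (by linarith)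
  nlinarith

theorem theorem1 :
    ∃ k : ℕ, ∀ ε : ℝ, 0 < ε → ∃ (l : ℕ) (α : ℕ → ℝ) (C : ℝ),
      2 ≤ l ∧ α 0 = 0 ∧ (∀ i, 1 ≤ i → i ≤ l → 0 < α i) ∧
      ∀ (N : Type*) [Fintype N] [DecidableEq N],
        -- the deterministic algorithm
        (∃ A : QueryAlg N (List (Finset (N × Fin l))), A.IsDeterministic ∧
          ∀ (f : Finset N → ℝ) (M : Matroid N), IsMonotoneSubmodular f → M.E = Set.univ →
            (∀ L ∈ A.outputs f (indepOracle M),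
              IsLocalSearchRun f M α L ∧
              IsApproxLocalOpt (auxObjective f α) (liftMatroid M l) ε (finalTuple L) ∧
              M.Indep (solution L : Set N) ∧
              ∀ O : Finset N, M.Indep (O : Set N) →
                (1 - 1 / Real.exp 1 - ε) * f O ≤ f (solution L)) ∧
            (0 < M.eRank.toNat →
              (A.queries f (indepOracle M) : ℝ) ≤
                C * ((Fintype.card N : ℝ) * (M.eRank.toNat : ℝ)) *
                  (1 + Real.log ((Fintype.card N : ℝ) + 1)) ^ k)) ∧
        -- the randomized algorithm
        (∃ A : QueryAlg N (List (Finset (N × Fin l))),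
          ∀ (f : Finset N → ℝ) (M : Matroid N), IsMonotoneSubmodular f → M.E = Set.univ →
            (∀ L ∈ A.outputs f (indepOracle M),
              IsLocalSearchRun f M α L ∧ M.Indep (solution L : Set N)) ∧
            1 - ε ≤ A.prob f (indepOracle M) (fun L =>
              IsApproxLocalOpt (auxObjective f α) (liftMatroid M l) ε (finalTuple L)) ∧
            (∀ O : Finset N, M.Indep (O : Set N) →
              (1 - 1 / Real.exp 1 - ε) * f O ≤
                A.expect f (indepOracle M) (fun L => f (solution L))) ∧
            (A.queries f (indepOracle M) : ℝ) ≤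
              C * ((Fintype.card N : ℝ) +
                  (M.eRank.toNat : ℝ) * Real.sqrt (Fintype.card N : ℝ)) *
                (1 + Real.log ((Fintype.card N : ℝ) + 1)) ^ k) := by
  classical
  refine ⟨1, fun ε hε => ?_⟩
  -- The error budget: one `η` each for replacing `(1 + 1/l)^(-l)` by `1/e`, for the loss `δ *
  -- auxWeightSum l`, and for the failure probability.
  obtain ⟨η, hη, hηε, hη1⟩ : ∃ η : ℝ, 0 < η ∧ 4 * η ≤ ε ∧ η ≤ 1 :=
    ⟨min ε 1 / 4, by positivity, by linarith [min_le_left ε 1], by linarith [min_le_right ε 1]⟩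
  obtain ⟨l, hl2, hl⟩ := exists_inv_pow_le hη
  have hW := auxWeightSum_nonneg l
  obtain ⟨δ, hδ, hδη, hδW⟩ : ∃ δ : ℝ, 0 < δ ∧ δ ≤ η ∧ δ * auxWeightSum l ≤ η := by
    refine ⟨η / (auxWeightSum l + 1), by positivity, div_le_self hη.le (by linarith), ?_⟩
    rw [div_mul_eq_mul_div, div_le_iff₀ (by positivity)]
    nlinarith
  have hδε : δ ≤ ε := by linarith
  obtain ⟨K, hK⟩ := exists_nat_ge (12 / (δ * η))
  have hKpos : (0 : ℝ) < K := lt_of_lt_of_le (by positivity) hK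
  have hK0 : 0 < K := by exact_mod_cast hKpos
  have hK1 : 1 / δ ≤ K := by
    refine le_trans ?_ hK
    rw [div_le_div_iff₀ hδ (by positivity)]
    nlinarith
  have hα : ∀ i ≤ l, 0 ≤ auxWeight l i := fun i => auxWeight_nonneg
  have hlpos : 1 ≤ l := by omega
  have hl1 : (1 : ℝ) ≤ l := by exact_mod_cast hlpos
  -- The constant collects `2 ^ l` from the simulation, `9 * K` from the cost bounds on `N × Fin l`,
  -- one `l` from the size of that ground set and one from its logarithm.
  refine ⟨l, auxWeight l, 2 ^ l * (9 * K * l ^ 2), hl2, auxWeight_zero l,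
    fun i h1 h2 => auxWeight_pos h1 h2, fun N _ _ => ⟨?_, ?_⟩⟩
  all_goals
    have hcard : Fintype.card (N × Fin l) = Fintype.card N * l := by simp
    have hn : (0 : ℝ) ≤ Fintype.card N := Nat.cast_nonneg _
    have hlog : 1 + Real.log ((Fintype.card (N × Fin l) : ℝ) + 1) ≤
        l * (1 + Real.log ((Fintype.card N : ℝ) + 1)) := hcard ▸ one_add_log_mul_le hlpos
    have hlog0 : 0 ≤ 1 + Real.log ((Fintype.card N : ℝ) + 1) := by
      have : 0 ≤ Real.log ((Fintype.card N : ℝ) + 1) := Real.log_nonneg (by linarith)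
      linarith
  · refine ⟨(QueryAlg.detSearch (N × Fin l) K).simulate (auxWeight l),
      (QueryAlg.detSearch_isDeterministic K).simulate _, fun f M hf _ => ⟨fun L hL => ?_, ?_⟩⟩
    · have hg := hf.auxObjective hα
      rw [QueryAlg.outputs_simulate] at hL
      obtain ⟨P, hP, hmax⟩ := exists_max_indep (auxObjective f (auxWeight l)) (liftMatroid M l)
      have hrun := (QueryAlg.detSearch_spec hg K hmax hL).1
      have hopt := QueryAlg.isApproxLocalOpt_detSearch hg hK0 hK1 hδ hL
      refine ⟨hrun, hopt.mono hg hδε, indep_unionOf hrun.isBase.indep _, fun O hO => ?_⟩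
      refine le_trans ?_ (approx_of_isApproxLocalOpt hlpos hf hδ.le hopt hO)
      exact mul_le_mul_of_nonneg_right (by linarith) (hf.nonneg O)
    · intro hr
      have hq := (QueryAlg.queries_simulate_le f M (auxWeight l) _).trans (Nat.mul_le_mul_left _
        (QueryAlg.queries_detSearch_le (hf.auxObjective hα) K (M := liftMatroid M l)
          (ρ := M.eRank.toNat) fun B hB => card_le_toNat_eRank_of_lift hB.indep))
      have hrn : M.eRank.toNat ≤ Fintype.card (N × Fin l) := by
        rw [hcard]
        exact (toNat_eRank_le_card M).trans (Nat.le_mul_of_pos_right _ hlpos)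
      have hcost := det_cost_le hr hrn hK0
      have hq' := (Nat.cast_le (α := ℝ)).2 hq
      rw [Nat.cast_mul, Nat.cast_pow, Nat.cast_ofNat] at hq'
      refine hq'.trans ((mul_le_mul_of_nonneg_left hcost (by positivity)).trans ?_)
      refine (mul_le_mul_of_nonneg_left (mul_le_mul_of_nonneg_left hlog (by positivity))
        (by positivity)).trans (le_of_eq ?_)
      rw [hcard]
      push_cast
      ring
  · refine ⟨(QueryAlg.randomSearch (N × Fin l) K).simulate (auxWeight l), fun f M hf _ => ?_⟩
    have hg := hf.auxObjective hα
    obtain ⟨B₀, hB₀⟩ : ∃ B₀ : Finset (N × Fin l),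
        (liftMatroid M l).IsBase (B₀ : Set (N × Fin l)) := by
      obtain ⟨B, hB⟩ := (liftMatroid M l).exists_isBase
      exact ⟨B.toFinset, by simpa using hB⟩
    -- The sample sizes depend on the exact size of a base, so here an upper bound on the rank is
    -- not enough.
    have hρ : ∀ B : Finset (N × Fin l), (liftMatroid M l).IsBase (B : Set (N × Fin l)) →
        B.card = B₀.card := fun B hB =>
      (card_le_of_indep hB₀ hB.indep).antisymm (card_le_of_indep hB hB₀.indep)
    have hX : 0 < B₀.card → 2 ≤ Fintype.card (N × Fin l) := by
      intro h
      obtain ⟨p, -⟩ := Finset.card_pos.1 h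
      have : 0 < Fintype.card N := Fintype.card_pos_iff.2 ⟨p.1⟩
      rw [hcard]
      nlinarith
    have hprob := QueryAlg.le_prob_isApproxLocalOpt_randomSearch hg hρ hX hK0 hδ hη hK
    unfold QueryAlg.prob at hprob ⊢
    simp only [QueryAlg.outputs_simulate, QueryAlg.expect_simulate]
    have hrun := fun L hL => QueryAlg.isExchangeRun_randomSearch (K := K) (L := L) hg hρ hL
    refine ⟨fun L hL => ⟨hrun L hL, indep_unionOf (hrun L hL).isBase.indep _⟩, ?_, ?_, ?_⟩
    · refine le_trans (by linarith) (hprob.trans (QueryAlg.expect_mono _ _ fun L _ => ?_))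
      by_cases h : IsApproxLocalOpt (auxObjective f (auxWeight l)) (liftMatroid M l) δ
          (L.getLastD ∅)
      · have h' : IsApproxLocalOpt (auxObjective f (auxWeight l)) (liftMatroid M l) ε
          (finalTuple L) := h.mono hg hδε
        rw [if_pos h, if_pos h']
      · rw [if_neg h]
        split_ifs <;> norm_num
    · intro O hO
      have hO0 := hf.nonneg O
      rcases le_total (1 - 1 / Real.exp 1 - 2 * η) 0 with hneg | hnonneg
      · refine (mul_nonpos_of_nonpos_of_nonneg (by linarith) hO0).trans ?_
        rw [← QueryAlg.expect_const (auxObjective f (auxWeight l))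
          (indepOracle (liftMatroid M l)) (QueryAlg.randomSearch (N × Fin l) K) 0]
        exact QueryAlg.expect_mono _ _ fun L _ => hf.nonneg _
      · have hc0 : 0 ≤ (1 - 1 / Real.exp 1 - 2 * η) * f O := mul_nonneg hnonneg hO0
        have h1 := mul_le_mul_of_nonneg_left hprob hc0
        rw [← QueryAlg.expect_const_mul] at h1
        have hexp : 0 < 1 / Real.exp 1 := by positivity
        have h2 : (1 - 1 / Real.exp 1 - ε) * f O ≤
            (1 - 1 / Real.exp 1 - 2 * η) * f O * (1 - η) := by
          have : 1 - 1 / Real.exp 1 - ε ≤ (1 - 1 / Real.exp 1 - 2 * η) * (1 - η) := by nlinarith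
          calc _ ≤ (1 - 1 / Real.exp 1 - 2 * η) * (1 - η) * f O :=
                mul_le_mul_of_nonneg_right this hO0
            _ = _ := by ring
        -- On success the ratio `1 - 1/e - 2η` applies; on failure `f ≥ 0` suffices, at the price of
        -- the factor `1 - η`.
        refine h2.trans (h1.trans (QueryAlg.expect_mono _ _ fun L _ => ?_))
        split_ifs with hcase
        · rw [mul_one]
          refine le_trans ?_ (approx_of_isApproxLocalOpt hlpos hf hδ.le hcase hO)
          exact mul_le_mul_of_nonneg_right (by linarith) hO0
        · rw [mul_zero]
          exact hf.nonneg _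
    · have hq := (QueryAlg.queries_simulate_le f M (auxWeight l) _).trans (Nat.mul_le_mul_left _
        (QueryAlg.queries_randomSearch_le hg K hρ))
      have hcost := rand_cost_le (Finset.card_le_univ B₀) hK0
      have hr : (B₀.card : ℝ) ≤ M.eRank.toNat := by
        exact_mod_cast card_le_toNat_eRank_of_lift hB₀.indep
      have hq' := (Nat.cast_le (α := ℝ)).2 hq
      rw [Nat.cast_mul, Nat.cast_pow, Nat.cast_ofNat] at hq'
      refine hq'.trans ((mul_le_mul_of_nonneg_left hcost (by positivity)).trans ?_)
      refine (mul_le_mul_of_nonneg_left (mul_le_mul_of_nonneg_left hlog (by positivity))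
        (by positivity)).trans ?_
      have hsqrt : Real.sqrt (Fintype.card (N × Fin l)) ≤ l * Real.sqrt (Fintype.card N) := by
        rw [hcard, Nat.cast_mul, mul_comm, Real.sqrt_mul (by positivity)]
        gcongr
        exact Real.sqrt_le_iff.2 ⟨by linarith, by nlinarith⟩
      have hsize : (Fintype.card (N × Fin l) : ℝ) +
          B₀.card * Real.sqrt (Fintype.card (N × Fin l)) ≤
          l * (Fintype.card N + M.eRank.toNat * Real.sqrt (Fintype.card N)) := by
        have := mul_le_mul hr hsqrt (Real.sqrt_nonneg _) (Nat.cast_nonneg _)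
        rw [hcard] at this ⊢
        push_cast at this ⊢
        linarith
      calc _ ≤ 2 ^ l * (9 * K * (l * (Fintype.card N + M.eRank.toNat *
              Real.sqrt (Fintype.card N))) * (l * (1 + Real.log ((Fintype.card N : ℝ) + 1)))) := by
            gcongr
        _ = _ := by ring
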